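/- Let $p, M \ge 1$ and let $\mathbf{X}$ be a random vector on $[0,1]^p$ with a density $f$ that is Lipschitz on $[0,1]^p$ and satisfies $c_1 \le f \le c_2$ there for constants $c_1, c_2 > 0$. Let $Y = m(\mathbf{X}) + \varepsilon$, where $m$ is square-integrable with respect to the law of $\mathbf X$ and the noise $\varepsilon$ is independent of $\mathbf{X}$. For $J \subset \{1,\dots,p\}$ write $\mathbf{X}^{(J)}$ for the subvector of $\mathbf X$ with indices in $J$. *Decomposition of $m$.* Let $\{m^{(J)}\}_J$ be the Hoeffding functional decomposition of $m$: square-integrable components with $m(\mathbf{X}) = \sum_{J} m^{(J)}(\mathbf{X}^{(J)})$ a.s. and $\mathbb{E}[m^{(J)}(\mathbf{X}^{(J)}) \mid \mathbf{X}^{(I)}] = 0$ a.s. for all $I \subsetneq J$. *Trees.* For each $n_T \ge 0$, let $T = \sum_{\ell=1}^M T_\ell$ be an ensemble of $M$ random binary regression trees with axis-aligned splits ($T$, the $T_\ell$ and the partitions below depend on $n_T$, while $M$ does not), trained on the first $n_T$ terms of an i.i.d. sequence of copies $(\mathbf{X}_i, Y_i)$ of $(\mathbf{X},Y)$; aggregation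 coefficients are included in the prediction functions $T_\ell$. Let $\mathcal{A}_\ell^{(j)}$ be the partition of $[0,1]$ into intervals delimited by the values of all splits of tree $\ell$ that involve variable $j$, and $\mathcal{A}_\ell^{(J)} = \prod_{j\in J}\mathcal{A}_\ell^{(j)}$ the corresponding product partition of $[0,1]^{J}$. *Tree decomposition.* Let $\{\eta_\ell^{(J)}\}$ be the tree Hoeffding decomposition of $T$, computed under the law of $\mathbf{X}$ for the realized trees: $\eta_\ell^{(J)}$ is piecewise constant over $\mathcal{A}_\ell^{(J)}$, $T_\ell(\mathbf{X}) = \sum_J \eta_\ell^{(J)}(\mathbf{X}^{(J)})$ a.s., and $\mathbb{E}[\eta_\ell^{(J)}(\mathbf{X}^{(J)}) \mid \mathbf{X}^{(I)} \in A] = 0$ for all $I \subsetneq J$ and all cells $A \in \mathcal{A}_\ell^{(I)}$ of positive probability. Put $\eta^{(J)} = \sum_{\ell} \eta_\ell^{(J)}$. In the following, $\mathbf{X}$ is a new input independent of the training data and of the trees, and expectations are over $\mathbf{X}$, the training data and the randomness of the trees. Assume that: 1. $T$ is $L_2$-consistent: $\mathbb{E}[(m(\mathbf{X}) - T(\mathbf{X}))^2]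 \to 0$ as $n_T \to \infty$; 2. the trees are bounded: there is a constant $B$ with $\sup_{\mathbf{x}\in[0,1]^p}|T_\ell(\mathbf{x})| \le B$ a.s. for all $\ell$ and all $n_T$; 3. the tree depth tends to infinity: for every $\ell$ and every $k$, the probability that all leaves of tree $\ell$ have depth at least $k$ tends to $1$ as $n_T \to \infty$; 4. there is $\gamma > 0$ such that, for all $\ell$ and $n_T$, almost surely the split of every internal node leaves at least a fraction $\gamma$ of the training observations of the node in each of its two children; 5. splits are randomized: there is $\pi > 0$ such that, for all $\ell$ and $n_T$, conditionally on the training data, on the splits of its strict ancestors and on being split, every node is split along each variable $j \in \{1,\dots,p\}$ with probability at least $\pi$. Then, for every $J \subset \{1,\dots,p\}$, $$\mathbb{E}\big[(\eta^{(J)}(\mathbf{X}^{(J)}) - m^{(J)}(\mathbf{X}^{(J)}))^2\big] \longrightarrow 0 \quad \text{as } n_T \to \infty .$$ -/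

import Mathlib

open MeasureTheory ProbabilityTheory Filter Topology

namespace TreeHFD

/-- The law on `[0,1]^p` with density `f` with respect to Lebesgue measure. -/
noncomputable def inputLaw {p : ℕ} (f : (Fin p → ℝ) → ℝ) : Measure (Fin p → ℝ) :=
  (volume.restrict (Set.Icc 0 1)).withDensity (fun x => ENNReal.ofReal (f x))

/-- Hoeffding functional decomposition (HFD) of `g` under the law `μ` of the input vector `X`:
square-integrable components `ν J`, functions of the subvector `X^(J)`, that sum to `g(X)` a.s.
and satisfy `E[ν^(J)(X^(J)) | X^(I)] = 0` a.s. for every strict subset `I` of `J`. -/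
structure IsHFD {p : ℕ} (μ : Measure (Fin p → ℝ)) (g : (Fin p → ℝ) → ℝ)
    (ν : (J : Finset (Fin p)) → (J → ℝ) → ℝ) : Prop where
  memLp : ∀ J : Finset (Fin p), MemLp (fun x => ν J (J.restrict x)) 2 μ
  sum_eq : ∀ᵐ x ∂μ, g x = ∑ J : Finset (Fin p), ν J (J.restrict x)
  condExp_eq_zero : ∀ J I : Finset (Fin p), I ⊂ J →
    μ[fun x => ν J (J.restrict x) |
      MeasurableSpace.comap (I.restrict : (Fin p → ℝ) → (I → ℝ)) inferInstance] =ᵐ[μ] 0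

/-- Binary regression trees with axis-aligned splits. `leaf c` predicts the constant `c`;
`node j s l r` sends a point `x` to `l` if `x j ≤ s` and to `r` if `s < x j`. -/
inductive RegTree (p : ℕ) : Type
  | leaf (c : ℝ) : RegTree p
  | node (j : Fin p) (s : ℝ) (l r : RegTree p) : RegTree p

namespace RegTree

variable {p : ℕ}

/-- The prediction function of a tree. -/
noncomputable def predict : RegTree p → (Fin p → ℝ) → ℝ
  | leaf c, _ => c
  | node j s l r, x => if x j ≤ s then predict l x else predict r x

/-- The values of all node splits of the tree that involve the variable `i`. -/
def splitValues : RegTree p → Fin p → List ℝ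
  | leaf _, _ => []
  | node j s l r, i => (if j = i then [s] else []) ++ (splitValues l i ++ splitValues r i)

/-- The smallest depth of a leaf: the tree is fully grown down to this depth. -/
def minLeafDepth : RegTree p → ℕ
  | leaf _ => 0
  | node _ _ l r => min (minLeafDepth l) (minLeafDepth r) + 1

/-- The variable split at the node of address `v` (read from the root, `false` is left), or
`none` if `v` is not the address of an internal node. -/
def splitVar : RegTree p → List Bool → Option (Fin p)
  | leaf _, _ => none
  | node j _ _ _, [] => some j
  | node _ _ l _, false :: v => splitVar l v
  | node _ _ _ r, true :: v => splitVar r v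

/-- The value at which the node of address `v` is split (`0` if `v` is not internal). -/
def splitVal : RegTree p → List Bool → ℝ
  | leaf _, _ => 0
  | node _ s _ _, [] => s
  | node _ _ l _, false :: v => splitVal l v
  | node _ _ _ r, true :: v => splitVal r v

/-- The value of the leaf of address `v` (`0` if `v` is not a leaf). -/
def leafVal : RegTree p → List Bool → ℝ
  | leaf c, [] => c
  | leaf _, _ :: _ => 0
  | node _ _ _ _, [] => 0
  | node _ _ l _, false :: v => leafVal l v
  | node _ _ _ r, true :: v => leafVal r v

/-- The set of points that reach the node of address `v` (empty if there is no such node). -/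
def region : RegTree p → List Bool → Set (Fin p → ℝ)
  | _, [] => Set.univ
  | leaf _, _ :: _ => ∅
  | node j s l _, false :: v => {x | x j ≤ s} ∩ region l v
  | node j s _ r, true :: v => {x | s < x j} ∩ region r v

/-- The coarsest σ-algebra on trees for which the split variable, the split value and the leaf
value at every address are measurable. -/
instance : MeasurableSpace (RegTree p) :=
  ⨆ v : List Bool,
    MeasurableSpace.comap (fun t : RegTree p => splitVar t v) ⊤ ⊔
    MeasurableSpace.comap (fun t : RegTree p => splitVal t v) inferInstance ⊔
    MeasurableSpace.comap (fun t : RegTree p => leafVal t v) inferInstance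

/-- The partition of `[0,1]` into the intervals cut out by all split values of variable `j`:
two points lie in the same interval when no split value separates them. -/
def axisPartition (t : RegTree p) (j : Fin p) : Set (Set ℝ) :=
  {A | ∃ a ∈ Set.Icc (0 : ℝ) 1,
    A = {b | b ∈ Set.Icc (0 : ℝ) 1 ∧ ∀ s ∈ t.splitValues j, (b ≤ s ↔ a ≤ s)}}

/-- The Cartesian tree partition of `[0,1]^J`: products of the one-dimensional intervals. -/
def cartesianPartition (t : RegTree p) (J : Finset (Fin p)) : Set (Set (J → ℝ)) :=
  {A | ∃ B : J → Set ℝ, (∀ j : J, B j ∈ t.axisPartition j) ∧ A = Set.univ.pi B}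

/-- Every split leaves at least the fraction `γ` of the node's observations in each child, where
the observations are the first `n` terms of `X`. -/
def IsBalanced (γ : ℝ) (n : ℕ) (X : ℕ → Fin p → ℝ) (t : RegTree p) : Prop :=
  ∀ v : List Bool, (t.splitVar v).isSome → ∀ b : Bool,
    γ * (Set.ncard {i | i < n ∧ X i ∈ t.region v} : ℝ) ≤
      (Set.ncard {i | i < n ∧ X i ∈ t.region (v ++ [b])} : ℝ)

end RegTree

/-- The tree HFD of the ensemble with trees `t ℓ` under the law `μ` of `X`: the component
`η ℓ J` is piecewise constant on the Cartesian tree partition `A_ℓ^(J)`, the components of tree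
`ℓ` sum to its prediction, and `E[η_ℓ^(J)(X^(J)) | X^(I) ∈ A] = 0` for every strict subset `I` of
`J` and every cell `A` of `A_ℓ^(I)`. (For a cell of probability `0` the last condition is void.) -/
structure IsTreeHFD {p M : ℕ} (μ : Measure (Fin p → ℝ)) (t : Fin M → RegTree p)
    (η : Fin M → (J : Finset (Fin p)) → (J → ℝ) → ℝ) : Prop where
  piecewise_const : ∀ (ℓ : Fin M) (J : Finset (Fin p)), ∀ A ∈ (t ℓ).cartesianPartition J,
    ∃ c : ℝ, ∀ z ∈ A, η ℓ J z = c
  sum_eq : ∀ ℓ : Fin M, ∀ᵐ x ∂μ,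
    (t ℓ).predict x = ∑ J : Finset (Fin p), η ℓ J (J.restrict x)
  integral_cond_eq_zero : ∀ (ℓ : Fin M) (J I : Finset (Fin p)), I ⊂ J →
    ∀ A ∈ (t ℓ).cartesianPartition I,
      ∫ x, η ℓ J (J.restrict x) ∂(ProbabilityTheory.cond μ (I.restrict ⁻¹' A)) = 0

/-- The σ-algebra of the training dataset `(X_i, Y_i)`, `i < n`. -/
@[reducible] def dataSigma {Ω : Type*} {p : ℕ} (X : ℕ → Ω → Fin p → ℝ) (Y : ℕ → Ω → ℝ) (n : ℕ) :
    MeasurableSpace Ω :=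
  ⨆ i : Fin n, MeasurableSpace.comap (fun ω => (X i ω, Y i ω)) inferInstance

/-- What is known when the node of address `v` of the random tree `τ` is about to be split: the
information `D`, the splits of all strict ancestors of `v`, and whether `v` is to be split. -/
@[reducible] def splitHistory {Ω : Type*} {p : ℕ} (D : MeasurableSpace Ω) (τ : Ω → RegTree p)
    (v : List Bool) : MeasurableSpace Ω :=
  D ⊔ (⨆ u : List Bool, ⨆ _ : u <+: v ∧ u ≠ v,
      MeasurableSpace.comap (fun ω => (τ ω).splitVar u) ⊤ ⊔
      MeasurableSpace.comap (fun ω => (τ ω).splitVal u) inferInstance) ⊔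
    MeasurableSpace.comap (fun ω => ((τ ω).splitVar v).isSome) ⊤

/-- Whatever the data and the earlier splits, each node that is split is split along each
variable with conditional probability at least `π`. -/
def RandomizedSplits {Ω : Type*} [MeasurableSpace Ω] {p : ℕ} (P : Measure Ω) (π : ℝ)
    (D : MeasurableSpace Ω) (τ : Ω → RegTree p) : Prop :=
  ∀ (v : List Bool) (j : Fin p), ∀ᵐ ω ∂P, ((τ ω).splitVar v).isSome →
    π ≤ (P[Set.indicator {ω' | (τ ω').splitVar v = some j} (fun _ => (1 : ℝ)) |
      splitHistory D τ v]) ω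

end TreeHFD

open TreeHFD

/-! Let `g_J` be the ensemble component on `J` minus the component of `m` on `J`. It is a function
of `x_J`, and the `g_J` sum to `T - m`, which is small in mean square. So the point is stability: a
small sum must have small terms.

Stability is proved against Lebesgue measure on the cube, whose L² norm is equivalent to that of the
input law. Let `P_I` average out the coordinates outside `I`. The alternating sum of the `P_I` over
`I ⊆ J` kills every function of `x_K` unless `J ⊆ K`. For a maximal `J` it therefore turns the whole
sum into `g_J` plus signed terms `P_I g_J` with `I ⊊ J`. If `g_J` is almost orthogonal to these
under the density `f`, then `g_J` is controlled by the sum; it is peeled off and the rest follows by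
induction (`exists_integral_sq_le_sum`).

Almost orthogonality has two sources. The components of `m` are exactly orthogonal to functions of
`x_I`. A tree component `h` is only centered on the cells over `I`; but `h` is constant along such a
cell and `f` is Lipschitz, so `P_I (h f)` has mean zero on the cell and varies there by at most the
mesh `δ` times `P_I |h|`, up to a constant. Hence it is of order `δ` itself
(`CellCentered.abs_marginal_le`). The L² bound on `h` that this requires comes from stability
applied to a single tree, where orthogonality is exact because `P_I h` is cellwise again
(`IsTreeHFD.integral_sq_le`).

It remains that the mesh tends to zero in probability (`tendsto_measure_not_meshLE`). Randomized
splits give the deep node around a fixed point many splits along each variable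
(`measure_splitCount_lt_le`). A uniform law of large numbers over boxes turns balance in
observations into balance in probability, so each split shrinks the side by a fixed factor
(`exists_box_of_isBalanced`). A wide cell would contain one of finitely many grid values, and the
node of the corresponding diagonal point would have to be wide as well; a union bound excludes this.
On the remaining event of small probability the error is bounded by a constant. -/

namespace TreeHFD

/-! ### Marginals and interactions under Lebesgue measure on the cube -/

section Marginal

variable {p : ℕ}

/-- Lebesgue measure on the unit cube. -/
noncomputable def cubeMeasure (p : ℕ) : Measure (Fin p → ℝ) :=
  volume.restrict (Set.Icc 0 1)

theorem cubeMeasure_eq_pi :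
    cubeMeasure p = Measure.pi (fun _ : Fin p => volume.restrict (Set.Icc (0 : ℝ) 1)) := by
  rw [← Measure.restrict_pi_pi, cubeMeasure, ← Set.pi_univ_Icc]
  rfl

instance : IsProbabilityMeasure (volume.restrict (Set.Icc (0 : ℝ) 1)) :=
  ⟨by simp⟩

instance : IsProbabilityMeasure (cubeMeasure p) := by
  rw [cubeMeasure_eq_pi]; infer_instance

theorem ae_mem_cube : ∀ᵐ x ∂(cubeMeasure p), x ∈ Set.Icc (0 : Fin p → ℝ) 1 :=
  ae_restrict_mem measurableSet_Icc

theorem piecewise_mem_cube (I : Finset (Fin p)) {x y : Fin p → ℝ}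
    (hx : x ∈ Set.Icc (0 : Fin p → ℝ) 1) (hy : y ∈ Set.Icc (0 : Fin p → ℝ) 1) :
    I.piecewise x y ∈ Set.Icc (0 : Fin p → ℝ) 1 :=
  I.piecewise_mem_Icc_of_mem_of_mem hx hy

theorem measurable_piecewise_prod (I : Finset (Fin p)) :
    Measurable (fun z : (Fin p → ℝ) × (Fin p → ℝ) => I.piecewise z.1 z.2) := by
  refine measurable_pi_lambda _ fun i => ?_
  by_cases hi : i ∈ I
  · simp only [Finset.piecewise_eq_of_mem _ _ _ hi]
    exact (measurable_pi_apply i).comp measurable_fst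
  · simp only [Finset.piecewise_eq_of_notMem _ _ _ hi]
    exact (measurable_pi_apply i).comp measurable_snd

/-- Resampling the coordinates outside `I` preserves Lebesgue measure on the cube. -/
theorem measurePreserving_piecewise (I : Finset (Fin p)) :
    MeasurePreserving (fun z : (Fin p → ℝ) × (Fin p → ℝ) => I.piecewise z.1 z.2)
      ((cubeMeasure p).prod (cubeMeasure p)) (cubeMeasure p) := by
  refine ⟨measurable_piecewise_prod I, ?_⟩
  rw [cubeMeasure_eq_pi]
  symm
  refine Measure.pi_eq fun s hs => ?_
  rw [Measure.map_apply (measurable_piecewise_prod I) (MeasurableSet.univ_pi hs)]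
  have : (fun z : (Fin p → ℝ) × (Fin p → ℝ) => I.piecewise z.1 z.2) ⁻¹' (Set.univ.pi s) =
      (Set.univ.pi fun i => if i ∈ I then s i else Set.univ) ×ˢ
        (Set.univ.pi fun i => if i ∈ I then Set.univ else s i) := by
    ext ⟨x, y⟩
    simp only [Set.mem_preimage, Set.mem_pi, Set.mem_univ, true_implies, Set.mem_prod]
    constructor
    · intro h
      refine ⟨fun i => ?_, fun i => ?_⟩ <;> have := h i <;> by_cases hi : i ∈ I <;> simp_all
    · rintro ⟨h1, h2⟩ i
      have h1 := h1 i
      have h2 := h2 i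
      by_cases hi : i ∈ I <;> simp_all
  rw [this, Measure.prod_prod, Measure.pi_pi, Measure.pi_pi, ← Finset.prod_mul_distrib]
  refine Finset.prod_congr rfl fun i _ => ?_
  by_cases hi : i ∈ I <;> simp [hi]

/-- The average of `h` over the coordinates outside `I`, under Lebesgue measure on the cube. -/
noncomputable def marginal (I : Finset (Fin p)) (h : (Fin p → ℝ) → ℝ) (x : Fin p → ℝ) : ℝ :=
  ∫ y, h (I.piecewise x y) ∂(cubeMeasure p)

/-- A function of the coordinates in `K` does not see whether the coordinates of `I` outside `K` are
kept or resampled. This makes terms of the alternating sum coincide. -/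
theorem marginal_inter (I K : Finset (Fin p)) {h : (Fin p → ℝ) → ℝ}
    (hh : DependsOn h (K : Set (Fin p))) : marginal (I ∩ K) h = marginal I h := by
  ext x
  refine integral_congr_ae (Eventually.of_forall fun y => hh fun i hi => ?_)
  have hi : i ∈ K := hi
  simp [Finset.piecewise, hi]

theorem marginal_self {J : Finset (Fin p)} {h : (Fin p → ℝ) → ℝ}
    (hh : DependsOn h (J : Set (Fin p))) : marginal J h = h := by
  ext x
  have : ∀ y, h (J.piecewise x y) = h x := fun y => hh fun i hi => by
    have hi : i ∈ J := hi
    simp [hi]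
  simp [marginal, this]

theorem dependsOn_marginal (I : Finset (Fin p)) (h : (Fin p → ℝ) → ℝ) :
    DependsOn (marginal I h) (I : Set (Fin p)) := by
  intro x x' hxx
  refine integral_congr_ae (Eventually.of_forall fun y => ?_)
  have : I.piecewise x y = I.piecewise x' y := by
    ext i
    by_cases hi : i ∈ I
    · simpa [hi] using hxx i hi
    · simp [hi]
  simp [this]

theorem sq_integral_le {α : Type*} [MeasurableSpace α] {μ : Measure α} [IsProbabilityMeasure μ]
    {h : α → ℝ} (hh : MemLp h 2 μ) : (∫ x, h x ∂μ) ^ 2 ≤ ∫ x, h x ^ 2 ∂μ := by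
  have h1 := variance_nonneg h μ
  rw [variance_eq_sub hh] at h1
  simpa using h1

/-- A marginal is the inner integral of `h` composed with `piecewise` over two independent points.
As `piecewise` preserves measure, Fubini on the product transfers integrability from `h` to its
marginals. -/
theorem integrable_comp_piecewise (I : Finset (Fin p)) {h : (Fin p → ℝ) → ℝ}
    (hh : Integrable h (cubeMeasure p)) :
    Integrable (fun z : (Fin p → ℝ) × (Fin p → ℝ) => h (I.piecewise z.1 z.2))
      ((cubeMeasure p).prod (cubeMeasure p)) :=
  (measurePreserving_piecewise I).integrable_comp_of_integrable hh

theorem integrable_marginal (I : Finset (Fin p)) {h : (Fin p → ℝ) → ℝ}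
    (hh : Integrable h (cubeMeasure p)) : Integrable (marginal I h) (cubeMeasure p) :=
  (integrable_comp_piecewise I hh).integral_prod_left

theorem integral_comp_piecewise (I : Finset (Fin p)) {h : (Fin p → ℝ) → ℝ}
    (hh : AEStronglyMeasurable h (cubeMeasure p)) :
    ∫ z : (Fin p → ℝ) × (Fin p → ℝ), h (I.piecewise z.1 z.2)
      ∂((cubeMeasure p).prod (cubeMeasure p)) = ∫ x, h x ∂(cubeMeasure p) := by
  have hp := measurePreserving_piecewise (p := p) I
  rw [← hp.map_eq] at hh
  rw [← integral_map hp.measurable.aemeasurable hh, hp.map_eq]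

theorem integral_marginal (I : Finset (Fin p)) {h : (Fin p → ℝ) → ℝ}
    (hh : Integrable h (cubeMeasure p)) :
    ∫ x, marginal I h x ∂(cubeMeasure p) = ∫ x, h x ∂(cubeMeasure p) := by
  rw [← integral_comp_piecewise I hh.aestronglyMeasurable,
    integral_prod _ (integrable_comp_piecewise I hh)]
  rfl

/-- Averaging out the coordinates outside `I` does not change integrals against functions of the
coordinates in `I`. -/
theorem integral_mul_marginal (I : Finset (Fin p)) {u h : (Fin p → ℝ) → ℝ}
    (hu : DependsOn u (I : Set (Fin p))) (huh : Integrable (fun x => u x * h x) (cubeMeasure p)) :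
    ∫ x, u x * marginal I h x ∂(cubeMeasure p) = ∫ x, u x * h x ∂(cubeMeasure p) := by
  rw [← integral_marginal I huh]
  refine integral_congr_ae (Eventually.of_forall fun x => ?_)
  have : ∀ y, u (I.piecewise x y) = u x := fun y => hu fun i hi => by
    have hi : i ∈ I := hi
    simp [hi]
  simp only [marginal, this, integral_const_mul]

theorem ae_memLp_comp_piecewise (I : Finset (Fin p)) {h : (Fin p → ℝ) → ℝ}
    (hh : MemLp h 2 (cubeMeasure p)) :
    ∀ᵐ x ∂(cubeMeasure p), MemLp (fun y => h (I.piecewise x y)) 2 (cubeMeasure p) := by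
  have h1 := hh.comp_measurePreserving (measurePreserving_piecewise I)
  have h2 := h1.integrable_sq.prod_right_ae
  have h3 := h1.aestronglyMeasurable.prodMk_left
  filter_upwards [h2, h3] with x hx hx'
  exact (memLp_two_iff_integrable_sq hx').2 hx

/-- Jensen on each fibre: the squared marginal of `h` is dominated by the marginal of `h ^ 2`, which
is integrable. -/
theorem memLp_marginal (I : Finset (Fin p)) {h : (Fin p → ℝ) → ℝ}
    (hh : MemLp h 2 (cubeMeasure p)) : MemLp (marginal I h) 2 (cubeMeasure p) := by
  have hi := integrable_marginal I (hh.integrable (by norm_num))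
  rw [memLp_two_iff_integrable_sq hi.aestronglyMeasurable]
  refine (integrable_marginal I hh.integrable_sq).mono' (hi.aestronglyMeasurable.pow 2) ?_
  filter_upwards [ae_memLp_comp_piecewise I hh] with x hx
  rw [Real.norm_of_nonneg (sq_nonneg _)]
  exact sq_integral_le hx

theorem integral_marginal_sq_le (I : Finset (Fin p)) {h : (Fin p → ℝ) → ℝ}
    (hh : MemLp h 2 (cubeMeasure p)) :
    ∫ x, marginal I h x ^ 2 ∂(cubeMeasure p) ≤ ∫ x, h x ^ 2 ∂(cubeMeasure p) := by
  rw [← integral_marginal I hh.integrable_sq]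
  refine integral_mono_ae (memLp_marginal I hh).integrable_sq
    (integrable_marginal I hh.integrable_sq) ?_
  filter_upwards [ae_memLp_comp_piecewise I hh] with x hx
  exact sq_integral_le hx

theorem ae_eq_marginal_of_ae_eq (I : Finset (Fin p)) {h h' : (Fin p → ℝ) → ℝ}
    (hh : h =ᵐ[cubeMeasure p] h') : marginal I h =ᵐ[cubeMeasure p] marginal I h' := by
  have h1 := (measurePreserving_piecewise I).quasiMeasurePreserving.ae_eq_comp hh
  filter_upwards [Measure.ae_ae_of_ae_prod h1] with x hx
  exact integral_congr_ae hx

/-- Linearity is only almost sure: on exceptional fibres a summand may fail to be integrable, and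
its integral is then the default value zero. -/
theorem marginal_sum (I : Finset (Fin p)) {κ : Type*} (s : Finset κ) {g : κ → (Fin p → ℝ) → ℝ}
    (hg : ∀ k ∈ s, Integrable (g k) (cubeMeasure p)) :
    marginal I (fun x => ∑ k ∈ s, g k x) =ᵐ[cubeMeasure p]
      fun x => ∑ k ∈ s, marginal I (g k) x := by
  have : ∀ᵐ x ∂(cubeMeasure p), ∀ k ∈ s,
      Integrable (fun y => g k (I.piecewise x y)) (cubeMeasure p) := by
    rw [Finset.eventually_all]
    exact fun k hk => (integrable_comp_piecewise I (hg k hk)).prod_right_ae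
  filter_upwards [this] with x hx
  exact integral_finsetSum s hx

/-- The top-order interaction of `h` on `J` under Lebesgue measure on the cube. -/
noncomputable def interaction (J : Finset (Fin p)) (h : (Fin p → ℝ) → ℝ) (x : Fin p → ℝ) : ℝ :=
  ∑ I ∈ J.powerset, (-1) ^ (J.card + I.card) * marginal I h x

/-- Choose `j` in `J` outside `K`. Since `h` ignores coordinate `j`, the terms of `I` and `insert j
I` have equal marginals and opposite signs. -/
theorem interaction_eq_zero {J K : Finset (Fin p)} (hJK : ¬ J ⊆ K) {h : (Fin p → ℝ) → ℝ}
    (hh : DependsOn h (K : Set (Fin p))) (x : Fin p → ℝ) : interaction J h x = 0 := by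
  obtain ⟨j, hjJ, hjK⟩ := Finset.not_subset.1 hJK
  rw [interaction, ← Finset.insert_erase hjJ,
    Finset.sum_powerset_insert (Finset.notMem_erase j J), ← Finset.sum_add_distrib]
  refine Finset.sum_eq_zero fun I hI => ?_
  have hjI : j ∉ I := fun h => Finset.notMem_erase j J (Finset.mem_powerset.1 hI h)
  have : marginal (insert j I) h = marginal I h := by
    rw [← marginal_inter I K hh, ← marginal_inter (insert j I) K hh,
      Finset.insert_inter_of_notMem hjK]
  rw [this, Finset.card_insert_of_notMem hjI]
  ring

/-- Isolates the term `I = J`, which has sign `+1` and is `h` itself. Orthogonality to the remaining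
proper marginals is what stability exploits. -/
theorem interaction_self {J : Finset (Fin p)} {h : (Fin p → ℝ) → ℝ}
    (hh : DependsOn h (J : Set (Fin p))) (x : Fin p → ℝ) :
    interaction J h x = h x +
      ∑ I ∈ J.ssubsets, (-1) ^ (J.card + I.card) * marginal I h x := by
  rw [interaction, Finset.ssubsets, ← Finset.add_sum_erase _ _ (Finset.mem_powerset_self J),
    marginal_self hh, ← two_mul]
  simp

end Marginal

/-! ### Stability of almost orthogonal decompositions -/

section Stability

variable {p : ℕ}

theorem memLp_interaction (J : Finset (Fin p)) {h : (Fin p → ℝ) → ℝ}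
    (hh : MemLp h 2 (cubeMeasure p)) : MemLp (interaction J h) 2 (cubeMeasure p) :=
  memLp_finsetSum _ fun I _ => (memLp_marginal I hh).const_mul _

/-- Cauchy–Schwarz over at most `2 ^ p` subsets costs one factor `2 ^ p`, and adding their
marginals, each a contraction in L², costs the other. -/
theorem integral_interaction_sq_le (J : Finset (Fin p)) {h : (Fin p → ℝ) → ℝ}
    (hh : MemLp h 2 (cubeMeasure p)) :
    ∫ x, interaction J h x ^ 2 ∂(cubeMeasure p) ≤ 4 ^ p * ∫ x, h x ^ 2 ∂(cubeMeasure p) := by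
  have hcard : (J.powerset.card : ℝ) ≤ 2 ^ p := by
    rw [Finset.card_powerset]
    push_cast
    exact pow_le_pow_right₀ (by norm_num) (by simpa using Finset.card_le_univ J)
  have h0 : 0 ≤ ∫ x, h x ^ 2 ∂(cubeMeasure p) := integral_nonneg fun x => sq_nonneg _
  have hi : ∀ I ∈ J.powerset, Integrable (fun x => marginal I h x ^ 2) (cubeMeasure p) :=
    fun I _ => (memLp_marginal I hh).integrable_sq
  calc ∫ x, interaction J h x ^ 2 ∂(cubeMeasure p)
      ≤ ∫ x, (J.powerset.card : ℝ) * ∑ I ∈ J.powerset, marginal I h x ^ 2 ∂(cubeMeasure p) := by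
        refine integral_mono (memLp_interaction J hh).integrable_sq
          ((integrable_finsetSum _ hi).const_mul _) fun x => ?_
        refine (sq_sum_le_card_mul_sum_sq (s := J.powerset)).trans_eq ?_
        congr 1
        refine Finset.sum_congr rfl fun I _ => ?_
        rw [mul_pow, ← pow_mul, mul_comm _ 2, pow_mul]
        simp
    _ = (J.powerset.card : ℝ) *
          ∑ I ∈ J.powerset, ∫ x, marginal I h x ^ 2 ∂(cubeMeasure p) := by
        rw [integral_const_mul, integral_finsetSum _ hi]
    _ ≤ (J.powerset.card : ℝ) * ∑ I ∈ J.powerset, ∫ x, h x ^ 2 ∂(cubeMeasure p) := by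
        exact mul_le_mul_of_nonneg_left
          (Finset.sum_le_sum fun I _ => integral_marginal_sq_le I hh) (Nat.cast_nonneg _)
    _ = (J.powerset.card : ℝ) * (J.powerset.card : ℝ) * ∫ x, h x ^ 2 ∂(cubeMeasure p) := by
        rw [Finset.sum_const, nsmul_eq_mul, mul_assoc]
    _ ≤ 2 ^ p * 2 ^ p * ∫ x, h x ^ 2 ∂(cubeMeasure p) := by gcongr
    _ = 4 ^ p * ∫ x, h x ^ 2 ∂(cubeMeasure p) := by rw [← mul_pow]; norm_num

variable {f : (Fin p → ℝ) → ℝ} {c₁ c₂ : ℝ}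

theorem integrable_mul_density (hfm : Measurable f) (hc₁ : 0 < c₁)
    (hf : ∀ x, c₁ ≤ f x ∧ f x ≤ c₂) {h : (Fin p → ℝ) → ℝ}
    (hh : Integrable h (cubeMeasure p)) : Integrable (fun x => h x * f x) (cubeMeasure p) :=
  hh.mul_bdd (c := c₂) hfm.aestronglyMeasurable (Eventually.of_forall fun x => by
    rw [Real.norm_of_nonneg (hc₁.le.trans (hf x).1)]; exact (hf x).2)

theorem mul_integral_le_integral_mul_density (hfm : Measurable f) (hc₁ : 0 < c₁)
    (hf : ∀ x, c₁ ≤ f x ∧ f x ≤ c₂) {h : (Fin p → ℝ) → ℝ} (h0 : ∀ x, 0 ≤ h x)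
    (hh : Integrable h (cubeMeasure p)) :
    c₁ * ∫ x, h x ∂(cubeMeasure p) ≤ ∫ x, h x * f x ∂(cubeMeasure p) := by
  rw [← integral_const_mul]
  refine integral_mono (hh.const_mul _) (integrable_mul_density hfm hc₁ hf hh) fun x => ?_
  simp only
  rw [mul_comm]
  exact mul_le_mul_of_nonneg_left (hf x).1 (h0 x)

theorem integral_mul_density_le (hfm : Measurable f) (hc₁ : 0 < c₁)
    (hf : ∀ x, c₁ ≤ f x ∧ f x ≤ c₂) {h : (Fin p → ℝ) → ℝ} (h0 : ∀ x, 0 ≤ h x)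
    (hh : Integrable h (cubeMeasure p)) :
    ∫ x, h x * f x ∂(cubeMeasure p) ≤ c₂ * ∫ x, h x ∂(cubeMeasure p) := by
  rw [← integral_const_mul]
  refine integral_mono (integrable_mul_density hfm hc₁ hf hh) (hh.const_mul _) fun x => ?_
  simp only
  rw [mul_comm c₂]
  exact mul_le_mul_of_nonneg_left (hf x).2 (h0 x)

/-- In a sum of functions of subvectors, a component on a maximal subset that is almost orthogonal
to its own lower-order marginals is controlled by the sum. -/
theorem integral_sq_le_of_maximal (hfm : Measurable f) (hc₁ : 0 < c₁)
    (hf : ∀ x, c₁ ≤ f x ∧ f x ≤ c₂) {s : Finset (Finset (Fin p))} {J : Finset (Fin p)}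
    (hJ : J ∈ s) (hmax : ∀ K ∈ s, J ⊆ K → K = J) {g : Finset (Fin p) → (Fin p → ℝ) → ℝ}
    (hg : ∀ K ∈ s, MemLp (g K) 2 (cubeMeasure p))
    (hdep : ∀ K ∈ s, DependsOn (g K) (K : Set (Fin p))) {ε : ℝ} (hε : 0 ≤ ε)
    (horth : ∀ I, I ⊂ J → |∫ x, g J x * marginal I (g J) x * f x ∂(cubeMeasure p)| ≤ ε) :
    c₁ * ∫ x, g J x ^ 2 ∂(cubeMeasure p) ≤
      c₂ * (4 ^ p * ∫ x, (∑ K ∈ s, g K x) ^ 2 ∂(cubeMeasure p)) + 2 * (2 ^ p * ε) := by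
  set S : (Fin p → ℝ) → ℝ := fun x => ∑ K ∈ s, g K x with hS
  have hSL : MemLp S 2 (cubeMeasure p) := memLp_finsetSum _ hg
  set r : (Fin p → ℝ) → ℝ := fun x =>
    ∑ I ∈ J.ssubsets, (-1) ^ (J.card + I.card) * marginal I (g J) x with hr
  have hrL : MemLp r 2 (cubeMeasure p) :=
    memLp_finsetSum _ fun I _ => (memLp_marginal I (hg J hJ)).const_mul _
  -- By maximality no other `K` in `s` contains `J`, so only `g J` survives the interaction.
  have hint : interaction J S =ᵐ[cubeMeasure p] fun x => g J x + r x := by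
    have : ∀ᵐ x ∂(cubeMeasure p), ∀ I ∈ J.powerset,
        marginal I S x = ∑ K ∈ s, marginal I (g K) x := by
      rw [Finset.eventually_all]
      exact fun I _ => marginal_sum I s fun K hK => (hg K hK).integrable (by norm_num)
    filter_upwards [this] with x hx
    have : interaction J S x = ∑ K ∈ s, interaction J (g K) x := by
      simp only [interaction]
      rw [Finset.sum_comm]
      refine Finset.sum_congr rfl fun I hI => ?_
      rw [hx I hI, Finset.mul_sum]
    rw [this, Finset.sum_eq_single_of_mem J hJ, interaction_self (hdep J hJ)]
    intro K hK hKJ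
    exact interaction_eq_zero (fun h => hKJ (hmax K hK h)) (hdep K hK) x
  have hgr : Integrable (fun x => g J x * r x * f x) (cubeMeasure p) :=
    integrable_mul_density hfm hc₁ hf ((hg J hJ).integrable_mul hrL)
  -- The cross term has at most `2 ^ p` summands, each bounded by `ε` by hypothesis.
  have hcross : |∫ x, g J x * r x * f x ∂(cubeMeasure p)| ≤ 2 ^ p * ε := by
    have hi : ∀ I ∈ J.ssubsets, Integrable (fun x =>
        (-1 : ℝ) ^ (J.card + I.card) * (g J x * marginal I (g J) x * f x)) (cubeMeasure p) :=
      fun I _ => (integrable_mul_density hfm hc₁ hf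
        ((hg J hJ).integrable_mul (memLp_marginal I (hg J hJ)))).const_mul _
    have : ∫ x, g J x * r x * f x ∂(cubeMeasure p) = ∑ I ∈ J.ssubsets,
        (-1 : ℝ) ^ (J.card + I.card) *
          ∫ x, g J x * marginal I (g J) x * f x ∂(cubeMeasure p) := by
      simp_rw [← integral_const_mul]
      rw [← integral_finsetSum _ hi]
      refine integral_congr_ae (Eventually.of_forall fun x => ?_)
      simp only [hr, Finset.mul_sum, Finset.sum_mul]
      exact Finset.sum_congr rfl fun I _ => by ring
    rw [this]
    refine (Finset.abs_sum_le_sum_abs _ _).trans ?_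
    have hle : ∀ I ∈ J.ssubsets, |(-1 : ℝ) ^ (J.card + I.card) *
          ∫ x, g J x * marginal I (g J) x * f x ∂(cubeMeasure p)| ≤ ε := by
      intro I hI
      rw [abs_mul, abs_pow, abs_neg, abs_one, one_pow, one_mul]
      exact horth I (Finset.mem_ssubsets.1 hI)
    refine (Finset.sum_le_sum hle).trans ?_
    rw [Finset.sum_const, nsmul_eq_mul]
    gcongr
    have : J.ssubsets.card ≤ 2 ^ p := by
      refine (Finset.card_le_card (Finset.erase_subset _ _)).trans ?_
      rw [Finset.card_powerset]
      exact Nat.pow_le_pow_right (by norm_num) (by simpa using Finset.card_le_univ J)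
    exact_mod_cast this
  -- Expand the square of `g J + r` and drop the nonnegative `r ^ 2`.
  have hlow : ∫ x, g J x ^ 2 * f x ∂(cubeMeasure p) +
      2 * ∫ x, g J x * r x * f x ∂(cubeMeasure p) ≤
        ∫ x, interaction J S x ^ 2 * f x ∂(cubeMeasure p) := by
    have h1 := integrable_mul_density hfm hc₁ hf (hg J hJ).integrable_sq
    rw [← integral_const_mul, ← integral_add h1 (hgr.const_mul 2)]
    refine integral_mono_ae (h1.add (hgr.const_mul 2))
      (integrable_mul_density hfm hc₁ hf (memLp_interaction J hSL).integrable_sq) ?_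
    filter_upwards [hint] with x hx
    simp only [hx]
    have := mul_nonneg (sq_nonneg (r x)) (hc₁.le.trans (hf x).1)
    nlinarith
  have hup := integral_mul_density_le hfm hc₁ hf (fun x => sq_nonneg _)
    (memLp_interaction J hSL).integrable_sq
  have hlow' := mul_integral_le_integral_mul_density hfm hc₁ hf (fun x => sq_nonneg _)
    (hg J hJ).integrable_sq
  have hc₂ : 0 ≤ c₂ := hc₁.le.trans ((hf 0).1.trans (hf 0).2)
  have hup' := mul_le_mul_of_nonneg_left (integral_interaction_sq_le J hSL) hc₂
  have := neg_le_of_abs_le hcross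
  linarith

/-- Stability of hierarchically orthogonal decompositions: components that are almost orthogonal to
their own lower-order marginals are controlled by their sum. -/
theorem exists_integral_sq_le_sum (c₁ c₂ : ℝ) (hc₁ : 0 < c₁) (s : Finset (Finset (Fin p))) :
    ∃ C : ℝ, 0 ≤ C ∧ ∀ f : (Fin p → ℝ) → ℝ, Measurable f → (∀ x, c₁ ≤ f x ∧ f x ≤ c₂) →
      ∀ (g : Finset (Fin p) → (Fin p → ℝ) → ℝ) (ε : ℝ), 0 ≤ ε →
      (∀ K ∈ s, MemLp (g K) 2 (cubeMeasure p)) →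
      (∀ K ∈ s, DependsOn (g K) (K : Set (Fin p))) →
      (∀ K ∈ s, ∀ I, I ⊂ K →
        |∫ x, g K x * marginal I (g K) x * f x ∂(cubeMeasure p)| ≤ ε) →
      ∀ J ∈ s, ∫ x, g J x ^ 2 ∂(cubeMeasure p) ≤
        C * (∫ x, (∑ K ∈ s, g K x) ^ 2 ∂(cubeMeasure p) + ε) := by
  induction s using Finset.strongInduction with
  | H s ih =>
    rcases s.eq_empty_or_nonempty with rfl | hs
    · exact ⟨0, le_rfl, by simp⟩
    obtain ⟨J, hJ⟩ := s.exists_maximal hs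
    have hJs : J ∈ s := hJ.prop
    have hmax : ∀ K ∈ s, J ⊆ K → K = J := fun K hK h => (hJ.eq_of_le hK h).symm
    obtain ⟨C, hC, hCs⟩ := ih (s.erase J) (Finset.erase_ssubset hJs)
    -- The constants are chosen before `f` is given, so the sign of `c₂` is not yet known; the
    -- absolute value keeps `D` nonnegative.
    set D : ℝ := (|c₂| * 4 ^ p + 2 * 2 ^ p) / c₁ with hD
    have hD0 : 0 ≤ D := by positivity
    -- `D` serves the maximal `J`. For the others, removing `g J` raises the squared norm of the sum
    -- to at most `2 * S + 2 * D * (S + ε)`, to which `C` and one more `ε` apply.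
    refine ⟨D + C * (2 + 2 * D + 1), by positivity, ?_⟩
    intro f hfm hf g ε hε hg hdep horth
    set S : ℝ := ∫ x, (∑ K ∈ s, g K x) ^ 2 ∂(cubeMeasure p) with hS
    have hS0 : 0 ≤ S := integral_nonneg fun x => sq_nonneg _
    have hgJ : ∫ x, g J x ^ 2 ∂(cubeMeasure p) ≤ D * (S + ε) := by
      have h1 := integral_sq_le_of_maximal hfm hc₁ hf hJs hmax hg hdep hε (horth J hJs)
      rw [hD, div_mul_eq_mul_div, le_div_iff₀ hc₁, mul_comm]
      refine h1.trans ?_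
      have h2 : c₂ * (4 ^ p * S) ≤ |c₂| * (4 ^ p * S) := by
        gcongr; exact le_abs_self _
      have h3 : 0 ≤ |c₂| * 4 ^ p * ε := by positivity
      have h4 : (0 : ℝ) ≤ 2 * 2 ^ p * S := by positivity
      calc _ ≤ |c₂| * (4 ^ p * S) + 2 * (2 ^ p * ε) := by gcongr
        _ ≤ _ := by nlinarith
    have hrest : ∫ x, (∑ K ∈ s.erase J, g K x) ^ 2 ∂(cubeMeasure p) ≤
        2 * S + 2 * ∫ x, g J x ^ 2 ∂(cubeMeasure p) := by
      have e1 : MemLp (fun x => ∑ K ∈ s, g K x) 2 (cubeMeasure p) := memLp_finsetSum _ hg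
      have e2 : MemLp (fun x => ∑ K ∈ s.erase J, g K x) 2 (cubeMeasure p) :=
        memLp_finsetSum _ fun K hK => hg K (Finset.mem_of_mem_erase hK)
      rw [hS, ← integral_const_mul, ← integral_const_mul,
        ← integral_add (e1.integrable_sq.const_mul 2) ((hg J hJs).integrable_sq.const_mul 2)]
      refine integral_mono e2.integrable_sq
        ((e1.integrable_sq.const_mul 2).add ((hg J hJs).integrable_sq.const_mul 2)) fun x => ?_
      simp only
      rw [← Finset.add_sum_erase s _ hJs]
      -- Parallelogram identity: the squares of `S - g J` and `S + g J` add up to `2 * S ^ 2 + 2 * g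
      -- J ^ 2`, with `S` here the full sum at `x`.
      nlinarith [sq_nonneg (g J x + (g J x + ∑ K ∈ s.erase J, g K x))]
    have hDS : 0 ≤ D * (S + ε) := by positivity
    intro K hK
    by_cases hKJ : K = J
    · subst hKJ
      refine hgJ.trans ?_
      gcongr
      nlinarith
    · have h1 := hCs f hfm hf g ε hε (fun K hK => hg K (Finset.mem_of_mem_erase hK))
        (fun K hK => hdep K (Finset.mem_of_mem_erase hK))
        (fun K hK => horth K (Finset.mem_of_mem_erase hK)) K (Finset.mem_erase.2 ⟨hKJ, hK⟩)
      refine h1.trans ?_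
      have h2 : ∫ x, (∑ K ∈ s.erase J, g K x) ^ 2 ∂(cubeMeasure p) + ε ≤
          (2 + 2 * D + 1) * (S + ε) := by
        linarith
      calc _ ≤ C * ((2 + 2 * D + 1) * (S + ε)) := by gcongr
        _ ≤ _ := by linarith

end Stability

/-! ### Cell labels, cellwise functions and centering on fine partitions -/

section Cells

variable {p : ℕ}

/-- The index of the cell of `axisPartition` containing `u`: the number of splits at or
above `u`. -/
noncomputable def RegTree.cellLabel (t : RegTree p) (j : Fin p) (u : ℝ) : ℕ :=
  (t.splitValues j).countP (fun s => decide (u ≤ s))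

theorem antitone_cellLabel (t : RegTree p) (j : Fin p) : Antitone (t.cellLabel j) :=
  fun u u' h => List.countP_mono_left fun s _ hs => by
    simp only [decide_eq_true_eq] at hs ⊢
    exact h.trans hs

/-- For `a ≤ b` the splits at or above `b` are among those at or above `a`, so equal counts force
the same splits. Counting gives a label that is monotone in the point, hence measurable. -/
theorem cellLabel_eq_iff (t : RegTree p) (j : Fin p) (u u' : ℝ) :
    t.cellLabel j u = t.cellLabel j u' ↔ ∀ s ∈ t.splitValues j, (u ≤ s ↔ u' ≤ s) := by
  constructor
  · intro h
    have key : ∀ (l : List ℝ) (a b : ℝ), a ≤ b →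
        l.countP (fun s => decide (a ≤ s)) = l.countP (fun s => decide (b ≤ s)) →
        ∀ s ∈ l, (a ≤ s ↔ b ≤ s) := by
      intro l a b hab
      induction l with
      | nil => simp
      | cons c l ih =>
        have hle : l.countP (fun s => decide (b ≤ s)) ≤ l.countP (fun s => decide (a ≤ s)) :=
          List.countP_mono_left fun s _ hs => by
            simp only [decide_eq_true_eq] at hs ⊢
            exact hab.trans hs
        intro h s hs
        simp only [List.countP_cons, decide_eq_true_eq] at h
        have hcb : b ≤ c → a ≤ c := hab.trans
        rcases List.mem_cons.1 hs with rfl | hs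
        · refine ⟨fun ha => ?_, hcb⟩
          by_contra hb
          simp only [ha, hb, if_true, if_false] at h
          omega
        · refine ih ?_ s hs
          by_cases ha : a ≤ c <;> by_cases hb : b ≤ c <;> simp only [ha, hb, if_true, if_false] at h
          · omega
          · omega
          · exact absurd (hcb hb) ha
          · omega
    rcases le_total u u' with hu | hu
    · exact key _ u u' hu h
    · exact fun s hs => (key _ u' u hu h.symm s hs).symm
  · intro h
    refine List.countP_congr fun s hs => ?_
    simpa using h s hs

theorem cellLabel_le (t : RegTree p) (j : Fin p) (u : ℝ) :
    t.cellLabel j u ≤ (t.splitValues j).length := List.countP_le_length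

/-- The label of the cell of the Cartesian partition on `I` (extended by zero outside `I`). -/
noncomputable def RegTree.labelOn (t : RegTree p) (I : Finset (Fin p)) (x : Fin p → ℝ) :
    Fin p → ℕ := fun i => if i ∈ I then t.cellLabel i (x i) else 0

theorem labelOn_eq_iff (t : RegTree p) (I : Finset (Fin p)) (x x' : Fin p → ℝ) :
    t.labelOn I x = t.labelOn I x' ↔
      ∀ i ∈ I, t.cellLabel i (x i) = t.cellLabel i (x' i) := by
  simp only [RegTree.labelOn, funext_iff]
  refine forall_congr' fun i => ?_
  by_cases hi : i ∈ I <;> simp [hi]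

theorem measurable_labelOn (t : RegTree p) (I : Finset (Fin p)) : Measurable (t.labelOn I) := by
  refine measurable_pi_lambda _ fun i => ?_
  by_cases hi : i ∈ I
  · simp only [RegTree.labelOn, hi, if_true]
    exact (antitone_cellLabel t i).measurable.comp (measurable_pi_apply i)
  · simp only [RegTree.labelOn, hi, if_false]
    exact measurable_const

theorem measurableSet_labelOn (t : RegTree p) (I : Finset (Fin p)) (n : Fin p → ℕ) :
    MeasurableSet {x | t.labelOn I x = n} :=
  measurable_labelOn t I (measurableSet_singleton n)

theorem finite_range_labelOn (t : RegTree p) (I : Finset (Fin p)) :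
    (Set.range (t.labelOn I)).Finite := by
  refine (Set.finite_Iic (fun i => (t.splitValues i).length)).subset ?_
  rintro _ ⟨x, rfl⟩ i
  simp only [RegTree.labelOn]
  split_ifs
  · exact cellLabel_le t i _
  · exact Nat.zero_le _

/-- `h` is constant on the cells of the Cartesian partition on `I`. -/
def IsCellwise (t : RegTree p) (I : Finset (Fin p)) (h : (Fin p → ℝ) → ℝ) : Prop :=
  ∀ x ∈ Set.Icc (0 : Fin p → ℝ) 1, ∀ x' ∈ Set.Icc (0 : Fin p → ℝ) 1,
    t.labelOn I x = t.labelOn I x' → h x = h x'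

variable {t : RegTree p} {I J : Finset (Fin p)} {h : (Fin p → ℝ) → ℝ}

theorem IsCellwise.exists_factor (hh : IsCellwise t I h) :
    ∃ Φ : (Fin p → ℕ) → ℝ, ∀ x ∈ Set.Icc (0 : Fin p → ℝ) 1, h x = Φ (t.labelOn I x) := by
  classical
  -- Labels not attained in the cube receive the irrelevant value zero.
  refine ⟨fun n => if H : ∃ x ∈ Set.Icc (0 : Fin p → ℝ) 1, t.labelOn I x = n
    then h H.choose else 0, fun x hx => ?_⟩
  have H : ∃ x' ∈ Set.Icc (0 : Fin p → ℝ) 1, t.labelOn I x' = t.labelOn I x := ⟨x, hx, rfl⟩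
  simp only [dif_pos H]
  exact hh x hx _ H.choose_spec.1 H.choose_spec.2.symm

/-- Labels form a countable discrete space, so every function of the label is measurable. -/
theorem IsCellwise.aestronglyMeasurable (hh : IsCellwise t I h) :
    AEStronglyMeasurable h (cubeMeasure p) := by
  obtain ⟨Φ, hΦ⟩ := hh.exists_factor
  refine ⟨fun x => Φ (t.labelOn I x),
    ((measurable_of_countable Φ).comp (measurable_labelOn t I)).stronglyMeasurable, ?_⟩
  filter_upwards [ae_mem_cube] with x hx using hΦ x hx

theorem IsCellwise.exists_bound (hh : IsCellwise t I h) :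
    ∃ C : ℝ, ∀ x ∈ Set.Icc (0 : Fin p → ℝ) 1, ‖h x‖ ≤ C := by
  obtain ⟨Φ, hΦ⟩ := hh.exists_factor
  obtain ⟨C, hC⟩ := ((finite_range_labelOn t I).image fun n => ‖Φ n‖).bddAbove
  refine ⟨C, fun x hx => ?_⟩
  rw [hΦ x hx]
  exact hC ⟨_, ⟨x, rfl⟩, rfl⟩

theorem IsCellwise.memLp (hh : IsCellwise t I h) : MemLp h 2 (cubeMeasure p) := by
  obtain ⟨C, hC⟩ := hh.exists_bound
  refine MemLp.of_bound hh.aestronglyMeasurable C ?_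
  filter_upwards [ae_mem_cube] with x hx using hC x hx

/-- Moving `x` inside its cell over `I`, with the resampled `y` fixed, does not change the `J`-label
of the spliced point. This is why the orthogonality inside one tree is exact. -/
theorem IsCellwise.marginal (hh : IsCellwise t J h) : IsCellwise t I (marginal I h) := by
  intro x hx x' hx' hxx
  refine integral_congr_ae ?_
  filter_upwards [ae_mem_cube] with y hy
  refine hh _ (piecewise_mem_cube I hx hy) _ (piecewise_mem_cube I hx' hy) ?_
  rw [labelOn_eq_iff] at hxx ⊢
  intro i _
  by_cases hi : i ∈ I
  · simpa [hi] using hxx i hi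
  · simp [hi]

variable {f : (Fin p → ℝ) → ℝ} {c₁ c₂ : ℝ}

/-- `h` has zero average, under the density `f`, over all cells of the partition on `I`. -/
def CellCentered (t : RegTree p) (I : Finset (Fin p)) (f h : (Fin p → ℝ) → ℝ) : Prop :=
  ∀ n : Fin p → ℕ,
    ∫ x, Set.indicator {x | t.labelOn I x = n} (fun x => h x * f x) x ∂(cubeMeasure p) = 0

/-- A centered function is orthogonal to the functions constant on the cells. -/
theorem CellCentered.integral_mul_eq_zero (hc : CellCentered t I f h)
    (hi : Integrable (fun x => h x * f x) (cubeMeasure p)) {u : (Fin p → ℝ) → ℝ}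
    (hu : IsCellwise t I u) : ∫ x, h x * u x * f x ∂(cubeMeasure p) = 0 := by
  obtain ⟨Φ, hΦ⟩ := hu.exists_factor
  set s := (finite_range_labelOn t I).toFinset with hs
  have h1 : (fun x => h x * u x * f x) =ᵐ[cubeMeasure p] fun x => ∑ n ∈ s, Φ n *
      Set.indicator {x | t.labelOn I x = n} (fun x => h x * f x) x := by
    filter_upwards [ae_mem_cube] with x hx
    rw [Finset.sum_eq_single_of_mem (t.labelOn I x) (by simp [hs])]
    · rw [Set.indicator_of_mem (show x ∈ {x' | t.labelOn I x' = t.labelOn I x} from rfl), hΦ x hx]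
      ring
    · intro n _ hn
      rw [Set.indicator_of_notMem (fun h => hn h.symm), mul_zero]
  rw [integral_congr_ae h1, integral_finsetSum _ fun n _ =>
    (hi.indicator (measurableSet_labelOn t I n)).const_mul _]
  refine Finset.sum_eq_zero fun n _ => ?_
  rw [integral_const_mul, hc n, mul_zero]

/-- All cells of the partitions of `[0,1]` of the tree have diameter at most `δ`. -/
def RegTree.MeshLE (t : RegTree p) (δ : ℝ) : Prop :=
  ∀ j : Fin p, ∀ u ∈ Set.Icc (0 : ℝ) 1, ∀ u' ∈ Set.Icc (0 : ℝ) 1,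
    t.cellLabel j u = t.cellLabel j u' → |u - u'| ≤ δ

theorem dist_piecewise_le {δ : ℝ} (hδ : 0 ≤ δ) (hmesh : t.MeshLE δ) {x x' : Fin p → ℝ}
    (hx : x ∈ Set.Icc (0 : Fin p → ℝ) 1) (hx' : x' ∈ Set.Icc (0 : Fin p → ℝ) 1)
    (hxx : t.labelOn I x = t.labelOn I x') (y : Fin p → ℝ) :
    dist (I.piecewise x y) (I.piecewise x' y) ≤ δ := by
  rw [dist_pi_le_iff hδ]
  intro i
  by_cases hi : i ∈ I
  · simp only [hi, Finset.piecewise_eq_of_mem, Real.dist_eq]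
    exact hmesh i _ ⟨hx.1 i, hx.2 i⟩ _ ⟨hx'.1 i, hx'.2 i⟩ ((labelOn_eq_iff t I x x').1 hxx i hi)
  · simpa [hi] using hδ

/-- On a fine partition, a centered cellwise function has almost zero marginals under a Lipschitz
density. -/
theorem CellCentered.abs_marginal_le (hc : CellCentered t I f h) (hh : IsCellwise t J h)
    (hfm : Measurable f) (hc₁ : 0 < c₁) (hf : ∀ x, c₁ ≤ f x ∧ f x ≤ c₂) {K : NNReal}
    (hLip : LipschitzWith K f) {δ : ℝ} (hδ : 0 ≤ δ) (hmesh : t.MeshLE δ) :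
    ∀ᵐ x ∂(cubeMeasure p), |TreeHFD.marginal I (fun x => h x * f x) x| ≤
      K * δ * TreeHFD.marginal I (fun x => |h x|) x := by
  have hi : Integrable (fun x => h x * f x) (cubeMeasure p) :=
    integrable_mul_density hfm hc₁ hf (hh.memLp.integrable (by norm_num))
  -- There are countably many labels, so almost every point lies in a cell of positive measure; this
  -- allows the division by the mass of the cell at the end.
  have hnull : ∀ᵐ x ∂(cubeMeasure p),
      (cubeMeasure p) {x' | t.labelOn I x' = t.labelOn I x} ≠ 0 := by
    have : ∀ᵐ x ∂(cubeMeasure p), ∀ n : Fin p → ℕ,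
        (cubeMeasure p) {x' | t.labelOn I x' = n} = 0 → t.labelOn I x ≠ n := by
      rw [ae_all_iff]
      intro n
      by_cases hn : (cubeMeasure p) {x' | t.labelOn I x' = n} = 0
      · filter_upwards [measure_eq_zero_iff_ae_notMem.1 hn] with x hx _ using hx
      · exact Eventually.of_forall fun x h0 => absurd h0 hn
    filter_upwards [this] with x hx h0 using hx _ h0 rfl
  have hgood : ∀ᵐ x ∂(cubeMeasure p), x ∈ Set.Icc (0 : Fin p → ℝ) 1 ∧
      Integrable (fun y => h (I.piecewise x y) * f (I.piecewise x y)) (cubeMeasure p) ∧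
      Integrable (fun y => |h (I.piecewise x y)|) (cubeMeasure p) := by
    filter_upwards [ae_mem_cube, (integrable_comp_piecewise I hi).prod_right_ae,
      (integrable_comp_piecewise I (hh.memLp.integrable (by norm_num)).abs).prod_right_ae]
      with x h1 h2 h3 using ⟨h1, h2, h3⟩
  filter_upwards [hnull, hgood] with x hx0 ⟨hx, hxi, hxa⟩
  set A := {x' | t.labelOn I x' = t.labelOn I x} with hA
  have hAm : MeasurableSet A := measurableSet_labelOn t I _
  set F := TreeHFD.marginal I (fun x => h x * f x) with hF
  have hFi : Integrable F (cubeMeasure p) := integrable_marginal I hi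
  -- The indicator of the cell depends only on the coordinates in `I`, so averaging out the others
  -- preserves the zero mean of `h * f`.
  have hzero : ∫ x' in A, F x' ∂(cubeMeasure p) = 0 := by
    have hdep : DependsOn (A.indicator fun _ => (1 : ℝ)) (I : Set (Fin p)) := by
      intro a b hab
      have : t.labelOn I a = t.labelOn I b :=
        (labelOn_eq_iff t I a b).2 fun i hi => by rw [hab i hi]
      simp [Set.indicator, hA, this]
    have e1 : ∀ k : (Fin p → ℝ) → ℝ, ∀ z,
        A.indicator (fun _ => (1 : ℝ)) z * k z = A.indicator k z := fun k z => by
      by_cases hz : z ∈ A <;> simp [hz]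
    have := integral_mul_marginal I hdep (h := fun x => h x * f x)
      (by simp_rw [e1 (fun x => h x * f x)]; exact hi.indicator hAm)
    simp_rw [e1 (fun x => h x * f x)] at this
    simp_rw [e1 (TreeHFD.marginal I (fun x => h x * f x))] at this
    rw [hc, integral_indicator hAm] at this
    exact this
  -- At `x` and `x'` in the same cell, spliced with the same `y`, the function `h` takes one value
  -- and `f` differs by at most `K * δ`.
  have hdiff : ∀ᵐ x' ∂(cubeMeasure p), x' ∈ A →
      ‖F x - F x'‖ ≤ K * δ * TreeHFD.marginal I (fun x => |h x|) x := by
    filter_upwards [hgood] with x' ⟨hx', hxi', _⟩ hxA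
    have hxx : t.labelOn I x' = t.labelOn I x := hxA
    simp only [hF, TreeHFD.marginal]
    rw [← integral_sub hxi hxi', ← integral_const_mul]
    refine norm_integral_le_of_norm_le (hxa.const_mul _) ?_
    filter_upwards [ae_mem_cube] with y hy
    have e : h (I.piecewise x' y) = h (I.piecewise x y) := by
      refine hh _ (piecewise_mem_cube I hx' hy) _ (piecewise_mem_cube I hx hy) ?_
      rw [labelOn_eq_iff] at hxx ⊢
      intro i _
      by_cases hi : i ∈ I
      · simpa [hi] using hxx i hi
      · simp [hi]
    rw [e, ← mul_sub, norm_mul, mul_comm, Real.norm_eq_abs (h _)]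
    refine mul_le_mul_of_nonneg_right ?_ (abs_nonneg _)
    rw [← dist_eq_norm]
    refine (hLip.dist_le_mul _ _).trans ?_
    gcongr
    exact dist_piecewise_le hδ hmesh hx hx' hxx.symm y
  have hAlt : (cubeMeasure p) A < ⊤ := measure_lt_top _ _
  -- As `F` averages to zero on the cell, `F x` is the mean of `F x - F x'` over the cell, so the
  -- oscillation bound controls `F x`.
  have h1 : ∫ x' in A, (F x - F x') ∂(cubeMeasure p) = F x * (cubeMeasure p).real A := by
    rw [integral_sub (integrable_const _) hFi.integrableOn, hzero, sub_zero, setIntegral_const,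
      smul_eq_mul, mul_comm]
  have h2 := norm_setIntegral_le_of_norm_le_const_ae (μ := cubeMeasure p) (s := A)
    (f := fun x' => F x - F x') hAlt ((ae_restrict_iff' hAm).2 hdiff)
  have hpos : 0 < (cubeMeasure p).real A := ENNReal.toReal_pos hx0 hAlt.ne
  rw [h1, norm_mul, Real.norm_of_nonneg hpos.le] at h2
  exact le_of_mul_le_mul_right h2 hpos

/-- Since `u` depends only on the coordinates in `I`, `h * f` may be replaced by its marginal, which
is of order `δ`. The product of `|u|` with the marginal of `|h|` is split into squares, and Jensen
bounds the second one. -/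
theorem CellCentered.abs_integral_mul_le (hc : CellCentered t I f h) (hh : IsCellwise t J h)
    (hfm : Measurable f) (hc₁ : 0 < c₁) (hf : ∀ x, c₁ ≤ f x ∧ f x ≤ c₂) {K : NNReal}
    (hLip : LipschitzWith K f) {δ : ℝ} (hδ : 0 ≤ δ) (hmesh : t.MeshLE δ) {u : (Fin p → ℝ) → ℝ}
    (hu : MemLp u 2 (cubeMeasure p)) (hdep : DependsOn u (I : Set (Fin p))) :
    |∫ x, h x * u x * f x ∂(cubeMeasure p)| ≤ K * δ *
      (∫ x, u x ^ 2 ∂(cubeMeasure p) + ∫ x, h x ^ 2 ∂(cubeMeasure p)) := by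
  have hint : Integrable (fun x => u x * (h x * f x)) (cubeMeasure p) := by
    have := integrable_mul_density hfm hc₁ hf (hu.integrable_mul hh.memLp)
    simpa [mul_assoc] using this
  have hha : MemLp (fun x => |h x|) 2 (cubeMeasure p) := hh.memLp.abs
  have hG := memLp_marginal I hha
  have hKδ : 0 ≤ (K : ℝ) * δ := mul_nonneg K.2 hδ
  have e : ∫ x, h x * u x * f x ∂(cubeMeasure p) =
      ∫ x, u x * TreeHFD.marginal I (fun x => h x * f x) x ∂(cubeMeasure p) := by
    rw [integral_mul_marginal I hdep hint]
    exact integral_congr_ae (Eventually.of_forall fun x => by ring)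
  have hi2 : Integrable (fun x => K * δ * (u x ^ 2 +
      TreeHFD.marginal I (fun x => |h x|) x ^ 2)) (cubeMeasure p) :=
    (hu.integrable_sq.add hG.integrable_sq).const_mul _
  rw [e, ← Real.norm_eq_abs]
  refine (norm_integral_le_of_norm_le hi2 ?_).trans ?_
  · filter_upwards [hc.abs_marginal_le hh hfm hc₁ hf hLip hδ hmesh] with x hx
    rw [Real.norm_eq_abs, abs_mul]
    refine (mul_le_mul_of_nonneg_left hx (abs_nonneg _)).trans ?_
    rw [← mul_assoc, mul_comm |u x|, mul_assoc]
    refine mul_le_mul_of_nonneg_left ?_ hKδ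
    rw [← sq_abs (u x)]
    nlinarith [sq_nonneg (|u x| - TreeHFD.marginal I (fun x => |h x|) x), sq_nonneg (|u x|),
      sq_nonneg (TreeHFD.marginal I (fun x => |h x|) x)]
  · rw [integral_const_mul, integral_add hu.integrable_sq hG.integrable_sq]
    refine mul_le_mul_of_nonneg_left ?_ hKδ
    have := integral_marginal_sq_le I hha
    simp only [sq_abs] at this
    gcongr

end Cells

/-! ### From the input law to deterministic error bounds -/

section InputLaw

variable {p M : ℕ} {f : (Fin p → ℝ) → ℝ} {c₁ c₂ : ℝ}

theorem inputLaw_congr {f f' : (Fin p → ℝ) → ℝ}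
    (h : ∀ x ∈ Set.Icc (0 : Fin p → ℝ) 1, f x = f' x) : inputLaw f = inputLaw f' := by
  refine withDensity_congr_ae ?_
  filter_upwards [ae_mem_cube] with x hx
  rw [h x hx]

theorem inputLaw_absolutelyContinuous : inputLaw f ≪ cubeMeasure p :=
  withDensity_absolutelyContinuous _ _

theorem integral_inputLaw (hfm : Measurable f) (hf0 : ∀ x, 0 ≤ f x) (h : (Fin p → ℝ) → ℝ) :
    ∫ x, h x ∂(inputLaw f) = ∫ x, h x * f x ∂(cubeMeasure p) := by
  rw [inputLaw, integral_withDensity_eq_integral_toReal_smul hfm.ennreal_ofReal (by simp)]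
  refine integral_congr_ae (Eventually.of_forall fun x => ?_)
  simp [ENNReal.toReal_ofReal (hf0 x), mul_comm]

theorem inputLaw_le (hf : ∀ x, f x ≤ c₂) : inputLaw f ≤ ENNReal.ofReal c₂ • cubeMeasure p := by
  rw [inputLaw, ← withDensity_const]
  exact withDensity_mono (Eventually.of_forall fun x => ENNReal.ofReal_le_ofReal (hf x))

theorem cubeMeasure_le (hc₁ : 0 < c₁) (hf : ∀ x, c₁ ≤ f x) :
    cubeMeasure p ≤ (ENNReal.ofReal c₁)⁻¹ • inputLaw f := by
  have h1 : ENNReal.ofReal c₁ • cubeMeasure p ≤ inputLaw f := by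
    rw [inputLaw, ← withDensity_const]
    exact withDensity_mono (Eventually.of_forall fun x => ENNReal.ofReal_le_ofReal (hf x))
  intro s
  have h2 := h1 s
  have h0 : ENNReal.ofReal c₁ ≠ 0 := by simpa using hc₁
  simp only [Measure.smul_apply, smul_eq_mul] at h2 ⊢
  rw [mul_comm, ← div_eq_mul_inv, ENNReal.le_div_iff_mul_le (Or.inl h0)
    (Or.inl ENNReal.ofReal_ne_top), mul_comm]
  exact h2

theorem cubeMeasure_absolutelyContinuous (hc₁ : 0 < c₁) (hf : ∀ x, c₁ ≤ f x) :
    cubeMeasure p ≪ inputLaw f :=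
  Measure.absolutelyContinuous_of_le_smul (cubeMeasure_le hc₁ hf)

theorem memLp_inputLaw_iff (hc₁ : 0 < c₁) (hf : ∀ x, c₁ ≤ f x ∧ f x ≤ c₂)
    {h : (Fin p → ℝ) → ℝ} : MemLp h 2 (inputLaw f) ↔ MemLp h 2 (cubeMeasure p) :=
  ⟨fun H => H.of_measure_le_smul (by simpa using hc₁) (cubeMeasure_le hc₁ fun x => (hf x).1),
    fun H => H.of_measure_le_smul ENNReal.ofReal_ne_top (inputLaw_le fun x => (hf x).2)⟩

theorem measurable_restrict_finset (I : Finset (Fin p)) :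
    Measurable (I.restrict : (Fin p → ℝ) → (I → ℝ)) :=
  measurable_pi_lambda _ fun _ => measurable_pi_apply _

theorem dependsOn_comp_restrict {J : Finset (Fin p)} (h : (J → ℝ) → ℝ) :
    DependsOn (fun x : Fin p → ℝ => h (J.restrict x)) (J : Set (Fin p)) := by
  intro x y hxy
  have : J.restrict x = J.restrict y := funext fun i => hxy i i.2
  simp only [this]

/-- A function of `X^(I)` that is given as a marginal is measurable with respect to `X^(I)`. -/
theorem stronglyMeasurable_marginal (I : Finset (Fin p)) {h : (Fin p → ℝ) → ℝ}
    (hh : StronglyMeasurable h) :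
    StronglyMeasurable[MeasurableSpace.comap (I.restrict : (Fin p → ℝ) → (I → ℝ)) inferInstance]
      (marginal I h) := by
  have hm : StronglyMeasurable (marginal I h) :=
    StronglyMeasurable.integral_prod_right (ν := cubeMeasure p)
      (f := fun x y => h (I.piecewise x y)) (hh.comp_measurable (measurable_piecewise_prod I))
  -- Extension by zero outside `I`; the marginal ignores those coordinates, so it factors through
  -- the restriction to `I`.
  let e : (I → ℝ) → (Fin p → ℝ) := fun z i => if hi : i ∈ I then z ⟨i, hi⟩ else 0
  have he : Measurable e := by
    refine measurable_pi_lambda _ fun i => ?_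
    by_cases hi : i ∈ I
    · simp only [e, hi, dif_pos]; exact measurable_pi_apply _
    · simp only [e, hi, dif_neg, not_false_eq_true]; exact measurable_const
  have : marginal I h = (marginal I h ∘ e) ∘ I.restrict := by
    ext x
    refine dependsOn_marginal I h fun i hi => ?_
    have hi : i ∈ I := hi
    simp [e, hi]
  rw [this]
  exact (hm.comp_measurable he).comp_measurable (comap_measurable _)

/-- The components of a Hoeffding decomposition are orthogonal to lower-order marginals. -/
theorem IsHFD.integral_mul_marginal_eq_zero {m : (Fin p → ℝ) → ℝ}
    {mc : (J : Finset (Fin p)) → (J → ℝ) → ℝ} (hmc : IsHFD (inputLaw f) m mc)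
    [IsFiniteMeasure (inputLaw f)] (hc₁ : 0 < c₁) (hf : ∀ x, c₁ ≤ f x ∧ f x ≤ c₂)
    {I J : Finset (Fin p)} (hIJ : I ⊂ J) {h : (Fin p → ℝ) → ℝ} (hh : MemLp h 2 (cubeMeasure p)) :
    ∫ x, mc J (J.restrict x) * marginal I h x ∂(inputLaw f) = 0 := by
  -- Pass to a strongly measurable version, so that its marginal is truly measurable with respect to
  -- `X^(I)` and can be pulled out of the conditional expectation.
  obtain ⟨h', hh', hae⟩ := hh.aestronglyMeasurable
  have hh2 : MemLp h' 2 (cubeMeasure p) := hh.ae_eq hae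
  have hmae : marginal I h =ᵐ[inputLaw f] marginal I h' :=
    inputLaw_absolutelyContinuous.ae_eq (ae_eq_marginal_of_ae_eq I hae)
  have e1 : ∫ x, mc J (J.restrict x) * marginal I h x ∂(inputLaw f) =
      ∫ x, (marginal I h' * (fun x => mc J (J.restrict x) : (Fin p → ℝ) → ℝ)) x ∂(inputLaw f) := by
    refine integral_congr_ae ?_
    filter_upwards [hmae] with x hx
    simp [hx, mul_comm]
  have hL := (memLp_inputLaw_iff hc₁ hf).2 (memLp_marginal I hh2)
  have hm := stronglyMeasurable_marginal I hh'
  have hle : MeasurableSpace.comap (I.restrict : (Fin p → ℝ) → (I → ℝ)) inferInstance ≤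
      (inferInstance : MeasurableSpace (Fin p → ℝ)) := (measurable_restrict_finset I).comap_le
  have hce := condExp_mul_of_stronglyMeasurable_left (μ := inputLaw f) hm
    (hL.integrable_mul (hmc.memLp J)) ((hmc.memLp J).integrable (by norm_num))
  rw [e1, ← integral_condExp hle, integral_congr_ae hce]
  refine integral_eq_zero_of_ae ?_
  filter_upwards [hmc.condExp_eq_zero J I hIJ] with x hx
  simp [hx]

variable {t : Fin M → RegTree p} {η : Fin M → (J : Finset (Fin p)) → (J → ℝ) → ℝ}

theorem IsTreeHFD.isCellwise {μ : Measure (Fin p → ℝ)} (hη : IsTreeHFD μ t η) (ℓ : Fin M)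
    (J : Finset (Fin p)) : IsCellwise (t ℓ) J (fun x => η ℓ J (J.restrict x)) := by
  intro x hx x' hx' hxx
  obtain ⟨c, hc⟩ := hη.piecewise_const ℓ J (Set.univ.pi fun j : J =>
    {b | b ∈ Set.Icc (0 : ℝ) 1 ∧ ∀ s ∈ (t ℓ).splitValues j, (b ≤ s ↔ x j ≤ s)})
    ⟨_, fun j => ⟨x j, ⟨hx.1 j, hx.2 j⟩, rfl⟩, rfl⟩
  rw [labelOn_eq_iff] at hxx
  simp only
  rw [hc (J.restrict x) fun j _ => ⟨⟨hx.1 j, hx.2 j⟩, fun s _ => Iff.rfl⟩,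
    hc (J.restrict x') fun j _ => ⟨⟨hx'.1 j, hx'.2 j⟩, fun s hs =>
      ((cellLabel_eq_iff (t ℓ) j (x j) (x' j)).1 (hxx j j.2) s hs).symm⟩]

/-- Multiplying a vanishing conditional mean by the mass of its cell gives a vanishing integral.
Null cells, and labels not attained in the cube, contribute nothing. -/
theorem IsTreeHFD.cellCentered [IsFiniteMeasure (inputLaw f)] (hη : IsTreeHFD (inputLaw f) t η)
    (hfm : Measurable f) (hf0 : ∀ x, 0 ≤ f x) (ℓ : Fin M) {I J : Finset (Fin p)} (hIJ : I ⊂ J) :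
    CellCentered (t ℓ) I f (fun x => η ℓ J (J.restrict x)) := by
  intro n
  by_cases hn : ∃ a ∈ Set.Icc (0 : Fin p → ℝ) 1, (t ℓ).labelOn I a = n
  · obtain ⟨a, ha, rfl⟩ := hn
    have h1 := hη.integral_cond_eq_zero ℓ J I hIJ (Set.univ.pi fun j : I =>
      {b | b ∈ Set.Icc (0 : ℝ) 1 ∧ ∀ s ∈ (t ℓ).splitValues j, (b ≤ s ↔ a j ≤ s)})
      ⟨_, fun j => ⟨a j, ⟨ha.1 j, ha.2 j⟩, rfl⟩, rfl⟩
    set A := (I.restrict : (Fin p → ℝ) → (I → ℝ)) ⁻¹' (Set.univ.pi fun j : I =>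
      {b | b ∈ Set.Icc (0 : ℝ) 1 ∧ ∀ s ∈ (t ℓ).splitValues j, (b ≤ s ↔ a j ≤ s)}) with hA
    have hAe : ∀ x ∈ Set.Icc (0 : Fin p → ℝ) 1,
        (x ∈ A ↔ (t ℓ).labelOn I x = (t ℓ).labelOn I a) := by
      intro x hx
      rw [labelOn_eq_iff]
      simp only [hA, Set.mem_preimage, Set.mem_pi, Set.mem_univ, true_implies, Set.mem_ofPred_eq,
        cellLabel_eq_iff]
      exact ⟨fun h i hi => (h ⟨i, hi⟩).2, fun h i => ⟨⟨hx.1 i, hx.2 i⟩, h i i.2⟩⟩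
    have hAae : A =ᵐ[inputLaw f] {x | (t ℓ).labelOn I x = (t ℓ).labelOn I a} := by
      filter_upwards [inputLaw_absolutelyContinuous ae_mem_cube] with x hx
      exact propext (hAe x hx)
    have h2 : ∫ x in A, η ℓ J (J.restrict x) ∂(inputLaw f) = 0 := by
      by_cases h0 : inputLaw f A = 0
      · rw [Measure.restrict_eq_zero.2 h0, integral_zero_measure]
      · rw [ProbabilityTheory.cond, integral_smul_measure, smul_eq_zero] at h1
        refine h1.resolve_left fun h => ?_
        rw [ENNReal.toReal_inv, inv_eq_zero] at h
        exact (ENNReal.toReal_pos h0 (measure_ne_top _ _)).ne' h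
    rw [setIntegral_congr_set hAae, ← integral_indicator (measurableSet_labelOn (t ℓ) I _),
      integral_inputLaw hfm hf0] at h2
    rw [← h2]
    refine integral_congr_ae (Eventually.of_forall fun x => ?_)
    simp only [Set.indicator]
    split_ifs <;> simp
  · refine integral_eq_zero_of_ae ?_
    filter_upwards [ae_mem_cube] with x hx
    have : x ∉ {x | (t ℓ).labelOn I x = n} := fun h => hn ⟨x, hx, h⟩
    simp [Set.indicator_of_notMem this]

/-- Under the density `f`, components that are almost orthogonal to their own lower-order marginals
are controlled by their sum, with the constant `C`. -/
def IsStable (f : (Fin p → ℝ) → ℝ) (C : ℝ) : Prop :=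
  ∀ (g : Finset (Fin p) → (Fin p → ℝ) → ℝ) (ε : ℝ), 0 ≤ ε →
    (∀ K, MemLp (g K) 2 (cubeMeasure p)) → (∀ K, DependsOn (g K) (K : Set (Fin p))) →
    (∀ K I, I ⊂ K → |∫ x, g K x * marginal I (g K) x * f x ∂(cubeMeasure p)| ≤ ε) →
    ∀ J, ∫ x, g J x ^ 2 ∂(cubeMeasure p) ≤
      C * (∫ x, (∑ K, g K x) ^ 2 ∂(cubeMeasure p) + ε)

theorem exists_isStable (hfm : Measurable f) (hc₁ : 0 < c₁) (hf : ∀ x, c₁ ≤ f x ∧ f x ≤ c₂) :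
    ∃ C : ℝ, 0 ≤ C ∧ IsStable f C := by
  obtain ⟨C, hC0, hC⟩ := exists_integral_sq_le_sum (p := p) c₁ c₂ hc₁ Finset.univ
  exact ⟨C, hC0, fun g ε hε h1 h2 h3 J => hC f hfm hf g ε hε (fun K _ => h1 K) (fun K _ => h2 K)
    (fun K _ => h3 K) J (Finset.mem_univ J)⟩

/-- The components of the tree decomposition of bounded trees are bounded in mean square,
uniformly over all trees. -/
theorem IsTreeHFD.integral_sq_le [IsFiniteMeasure (inputLaw f)]
    (hη : IsTreeHFD (inputLaw f) t η) (hfm : Measurable f) (hc₁ : 0 < c₁)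
    (hf : ∀ x, c₁ ≤ f x ∧ f x ≤ c₂) {C : ℝ}
    (hC : IsStable f C) (hC0 : 0 ≤ C) {B : ℝ} (ℓ : Fin M)
    (hB : ∀ x ∈ Set.Icc (0 : Fin p → ℝ) 1, |(t ℓ).predict x| ≤ B) (J : Finset (Fin p)) :
    ∫ x, η ℓ J (J.restrict x) ^ 2 ∂(cubeMeasure p) ≤ C * B ^ 2 := by
  have hf0 : ∀ x, 0 ≤ f x := fun x => hc₁.le.trans (hf x).1
  -- Stability with tolerance zero: the marginal of a tree component is constant on the cells over
  -- `I`, where the component is centered.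
  have h1 := hC (fun J x => η ℓ J (J.restrict x)) 0 le_rfl (fun K => (hη.isCellwise ℓ K).memLp)
    (fun K => dependsOn_comp_restrict _) (fun K I hIK => by
      rw [(hη.cellCentered hfm hf0 ℓ hIK).integral_mul_eq_zero
        (integrable_mul_density hfm hc₁ hf ((hη.isCellwise ℓ K).memLp.integrable (by norm_num)))
        (hη.isCellwise ℓ K).marginal, abs_zero]) J
  refine h1.trans (mul_le_mul_of_nonneg_left ?_ hC0)
  rw [add_zero]
  calc ∫ x, (∑ K : Finset (Fin p), η ℓ K (K.restrict x)) ^ 2 ∂(cubeMeasure p)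
      ≤ ∫ _, B ^ 2 ∂(cubeMeasure p) := by
        refine integral_mono_ae (memLp_finsetSum _ fun K _ =>
          (hη.isCellwise ℓ K).memLp).integrable_sq (integrable_const _) ?_
        filter_upwards [ae_mem_cube, cubeMeasure_absolutelyContinuous hc₁ (fun x => (hf x).1)
          (hη.sum_eq ℓ)] with x hx hs
        rw [← hs]
        exact sq_le_sq' (abs_le.1 (hB x hx)).1 (abs_le.1 (hB x hx)).2
    _ = B ^ 2 := by simp

theorem sq_sum_sub_le {ι : Type*} (s : Finset ι) (a : ι → ℝ) (b : ℝ) :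
    (∑ i ∈ s, a i - b) ^ 2 ≤ 2 * (s.card * ∑ i ∈ s, a i ^ 2) + 2 * b ^ 2 := by
  have h := sq_sum_le_card_mul_sum_sq (s := s) (f := a)
  nlinarith [sq_nonneg (∑ i ∈ s, a i + b)]

/-- The difference between the components of the tree decomposition of an ensemble and of the
Hoeffding decomposition of `m` is bounded, and it is small when the ensemble is close to `m` and
the partitions are fine. -/
theorem exists_integral_sub_sq_le (hfm : Measurable f) (hc₁ : 0 < c₁)
    (hf : ∀ x, c₁ ≤ f x ∧ f x ≤ c₂) [IsFiniteMeasure (inputLaw f)] {K : NNReal}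
    (hLip : LipschitzWith K f) {m : (Fin p → ℝ) → ℝ} {mc : (J : Finset (Fin p)) → (J → ℝ) → ℝ}
    (hmc : IsHFD (inputLaw f) m mc) (B : ℝ) (M : ℕ) :
    ∃ C D R : ℝ, 0 ≤ C ∧ 0 ≤ D ∧ 0 ≤ R ∧ ∀ (t : Fin M → RegTree p)
      (η : Fin M → (J : Finset (Fin p)) → (J → ℝ) → ℝ), IsTreeHFD (inputLaw f) t η →
      (∀ ℓ, ∀ x ∈ Set.Icc (0 : Fin p → ℝ) 1, |(t ℓ).predict x| ≤ B) →
      MemLp (fun x => m x - ∑ ℓ, (t ℓ).predict x) 2 (inputLaw f) ∧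
      ∀ J : Finset (Fin p),
        MemLp (fun x => (∑ ℓ, η ℓ J (J.restrict x)) - mc J (J.restrict x)) 2 (inputLaw f) ∧
        ∫ x, ((∑ ℓ, η ℓ J (J.restrict x)) - mc J (J.restrict x)) ^ 2 ∂(inputLaw f) ≤ R ∧
        ∀ δ : ℝ, 0 ≤ δ → (∀ ℓ, (t ℓ).MeshLE δ) →
          ∫ x, ((∑ ℓ, η ℓ J (J.restrict x)) - mc J (J.restrict x)) ^ 2 ∂(inputLaw f) ≤
            C * ∫ x, (m x - ∑ ℓ, (t ℓ).predict x) ^ 2 ∂(inputLaw f) + D * δ := by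
  obtain ⟨C, hC0, hC⟩ := exists_isStable hfm hc₁ hf
  have hf0 : ∀ x, 0 ≤ f x := fun x => hc₁.le.trans (hf x).1
  have hc₂ : 0 ≤ c₂ := hc₁.le.trans ((hf 0).1.trans (hf 0).2)
  -- Bounds the squared norm of every `g J` by the squares of the `M` tree components, each at most
  -- `C * B ^ 2`, and of the component of `m`. Summing over all subsets makes it uniform in `J`.
  set R : ℝ := 2 * (M * (M * (C * B ^ 2))) +
    2 * ∑ J : Finset (Fin p), ∫ x, mc J (J.restrict x) ^ 2 ∂(cubeMeasure p) with hR
  have hR0 : 0 ≤ R := by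
    have : 0 ≤ ∑ J : Finset (Fin p), ∫ x, mc J (J.restrict x) ^ 2 ∂(cubeMeasure p) :=
      Finset.sum_nonneg fun J _ => integral_nonneg fun x => sq_nonneg _
    positivity
  have hCB : 0 ≤ C * B ^ 2 := by positivity
  refine ⟨c₂ * C / c₁, c₂ * C * (M * (K * (R + C * B ^ 2))), c₂ * R, by positivity,
    by positivity, by positivity, ?_⟩
  intro t η hη hB
  have hηL : ∀ ℓ J, MemLp (fun x => η ℓ J (J.restrict x)) 2 (cubeMeasure p) :=
    fun ℓ J => (hη.isCellwise ℓ J).memLp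
  have hmL : ∀ J : Finset (Fin p), MemLp (fun x => mc J (J.restrict x)) 2 (cubeMeasure p) :=
    fun J => (memLp_inputLaw_iff hc₁ hf).1 (hmc.memLp J)
  have hηB := fun ℓ J => hη.integral_sq_le hfm hc₁ hf hC hC0 ℓ (hB ℓ) J
  set g : Finset (Fin p) → (Fin p → ℝ) → ℝ :=
    fun J x => (∑ ℓ, η ℓ J (J.restrict x)) - mc J (J.restrict x) with hg
  have hgL : ∀ J, MemLp (g J) 2 (cubeMeasure p) := fun J =>
    (memLp_finsetSum _ fun ℓ _ => hηL ℓ J).sub (hmL J)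
  -- Exchanging the sums over trees and subsets shows that the `g J` decompose the prediction error,
  -- up to sign.
  have hsum : (fun x => ∑ J, g J x) =ᵐ[cubeMeasure p]
      fun x => -(m x - ∑ ℓ, (t ℓ).predict x) := by
    have h1 : ∀ᵐ x ∂(inputLaw f), ∀ ℓ,
        (t ℓ).predict x = ∑ J : Finset (Fin p), η ℓ J (J.restrict x) :=
      ae_all_iff.2 hη.sum_eq
    filter_upwards [cubeMeasure_absolutelyContinuous hc₁ (fun x => (hf x).1) h1,
      cubeMeasure_absolutelyContinuous hc₁ (fun x => (hf x).1) hmc.sum_eq] with x h1 h2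
    simp only [hg, Finset.sum_sub_distrib, h1, h2]
    rw [Finset.sum_comm]
    ring
  have hTL : MemLp (fun x => m x - ∑ ℓ, (t ℓ).predict x) 2 (cubeMeasure p) := by
    have := ((memLp_finsetSum Finset.univ fun J _ => hgL J).ae_eq hsum).neg
    simpa [Pi.neg_def] using this
  refine ⟨(memLp_inputLaw_iff hc₁ hf).2 hTL, fun J => ⟨(memLp_inputLaw_iff hc₁ hf).2 (hgL J), ?_⟩⟩
  have hgR : ∀ J, ∫ x, g J x ^ 2 ∂(cubeMeasure p) ≤ R := by
    intro J
    have i1 : Integrable (fun x => ∑ ℓ, η ℓ J (J.restrict x) ^ 2) (cubeMeasure p) :=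
      integrable_finsetSum _ fun ℓ _ => (hηL ℓ J).integrable_sq
    have i2 := (hmL J).integrable_sq
    have h1 : ∫ x, g J x ^ 2 ∂(cubeMeasure p) ≤
        2 * (M * ∑ ℓ, ∫ x, η ℓ J (J.restrict x) ^ 2 ∂(cubeMeasure p)) +
          2 * ∫ x, mc J (J.restrict x) ^ 2 ∂(cubeMeasure p) := by
      rw [← integral_finsetSum _ fun ℓ _ => (hηL ℓ J).integrable_sq, ← integral_const_mul,
        ← integral_const_mul, ← integral_const_mul,
        ← integral_add ((i1.const_mul _).const_mul _) (i2.const_mul _)]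
      refine integral_mono (hgL J).integrable_sq
        (((i1.const_mul _).const_mul _).add (i2.const_mul _)) fun x => ?_
      simpa using sq_sum_sub_le Finset.univ (fun ℓ => η ℓ J (J.restrict x)) (mc J (J.restrict x))
    refine h1.trans ?_
    have h2 : ∑ ℓ, ∫ x, η ℓ J (J.restrict x) ^ 2 ∂(cubeMeasure p) ≤ M * (C * B ^ 2) := by
      simpa using Finset.sum_le_sum fun ℓ (_ : ℓ ∈ Finset.univ) => hηB ℓ J
    have h3 : ∫ x, mc J (J.restrict x) ^ 2 ∂(cubeMeasure p) ≤
        ∑ J : Finset (Fin p), ∫ x, mc J (J.restrict x) ^ 2 ∂(cubeMeasure p) :=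
      Finset.single_le_sum (f := fun J : Finset (Fin p) =>
        ∫ x, mc J (J.restrict x) ^ 2 ∂(cubeMeasure p))
        (fun J _ => integral_nonneg fun x => sq_nonneg _) (Finset.mem_univ J)
    rw [hR]
    gcongr
  have hup : ∫ x, g J x ^ 2 ∂(inputLaw f) ≤ c₂ * ∫ x, g J x ^ 2 ∂(cubeMeasure p) := by
    rw [integral_inputLaw hfm hf0]
    exact integral_mul_density_le hfm hc₁ hf (fun x => sq_nonneg _) (hgL J).integrable_sq
  refine ⟨hup.trans (mul_le_mul_of_nonneg_left (hgR J) hc₂), fun δ hδ hmesh => hup.trans ?_⟩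
  -- The component of `m` drops out by exact orthogonality. Each tree contributes `K * δ` times the
  -- squared norms of the marginal of `g J`, at most `R`, and of its own component.
  have horth : ∀ J I, I ⊂ J → |∫ x, g J x * marginal I (g J) x * f x ∂(cubeMeasure p)| ≤
      M * (K * (R + C * B ^ 2)) * δ := by
    intro J I hIJ
    set u := marginal I (g J) with hu
    have huL : MemLp u 2 (cubeMeasure p) := memLp_marginal I (hgL J)
    have hi : ∀ ℓ ∈ (Finset.univ : Finset (Fin M)),
        Integrable (fun x => η ℓ J (J.restrict x) * u x * f x) (cubeMeasure p) :=
      fun ℓ _ => integrable_mul_density hfm hc₁ hf ((hηL ℓ J).integrable_mul huL)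
    have hz : ∫ x, mc J (J.restrict x) * u x * f x ∂(cubeMeasure p) = 0 := by
      rw [← integral_inputLaw hfm hf0 (fun x => mc J (J.restrict x) * u x)]
      exact hmc.integral_mul_marginal_eq_zero hc₁ hf hIJ (hgL J)
    have e : ∫ x, g J x * u x * f x ∂(cubeMeasure p) =
        ∑ ℓ, ∫ x, η ℓ J (J.restrict x) * u x * f x ∂(cubeMeasure p) := by
      have hmi : Integrable (fun x => mc J (J.restrict x) * u x * f x) (cubeMeasure p) :=
        integrable_mul_density hfm hc₁ hf ((hmL J).integrable_mul huL)
      rw [← integral_finsetSum _ hi, ← sub_zero (∫ x, ∑ ℓ, _ ∂_), ← hz,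
        ← integral_sub (integrable_finsetSum _ hi) hmi]
      refine integral_congr_ae (Eventually.of_forall fun x => ?_)
      simp only [hg, sub_mul, Finset.sum_mul]
    rw [e]
    refine (Finset.abs_sum_le_sum_abs _ _).trans ?_
    have hb : ∀ ℓ ∈ (Finset.univ : Finset (Fin M)),
        |∫ x, η ℓ J (J.restrict x) * u x * f x ∂(cubeMeasure p)| ≤
          K * δ * (R + C * B ^ 2) := by
      intro ℓ _
      refine ((hη.cellCentered hfm hf0 ℓ hIJ).abs_integral_mul_le (hη.isCellwise ℓ J) hfm hc₁ hf
        hLip hδ (hmesh ℓ) huL (dependsOn_marginal I _)).trans ?_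
      have := (integral_marginal_sq_le I (hgL J)).trans (hgR J)
      have := hηB ℓ J
      gcongr
    refine (Finset.sum_le_sum hb).trans_eq ?_
    simp
    ring
  have hdep : ∀ J, DependsOn (g J) (J : Set (Fin p)) := fun J =>
    dependsOn_comp_restrict (fun z => (∑ ℓ, η ℓ J z) - mc J z)
  have hfin := hC g (M * (K * (R + C * B ^ 2)) * δ) (by positivity) hgL hdep horth J
  have hS : ∫ x, (∑ J, g J x) ^ 2 ∂(cubeMeasure p) =
      ∫ x, (m x - ∑ ℓ, (t ℓ).predict x) ^ 2 ∂(cubeMeasure p) := by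
    refine integral_congr_ae ?_
    filter_upwards [hsum] with x hx
    rw [hx, neg_sq]
  have hlow := mul_integral_le_integral_mul_density hfm hc₁ hf (fun x => sq_nonneg _)
    hTL.integrable_sq
  rw [← integral_inputLaw hfm hf0 (fun x => (m x - ∑ ℓ, (t ℓ).predict x) ^ 2)] at hlow
  rw [hS] at hfin
  have h5 : ∫ x, (m x - ∑ ℓ, (t ℓ).predict x) ^ 2 ∂(cubeMeasure p) ≤
      (∫ x, (m x - ∑ ℓ, (t ℓ).predict x) ^ 2 ∂(inputLaw f)) / c₁ := by
    rw [le_div_iff₀ hc₁, mul_comm]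
    exact hlow
  calc c₂ * ∫ x, g J x ^ 2 ∂(cubeMeasure p)
      ≤ c₂ * (C * ((∫ x, (m x - ∑ ℓ, (t ℓ).predict x) ^ 2 ∂(inputLaw f)) / c₁ +
          M * (K * (R + C * B ^ 2)) * δ)) := by
        refine mul_le_mul_of_nonneg_left (hfin.trans ?_) hc₂
        gcongr
    _ = _ := by ring

end InputLaw

/-! ### Regions and split counts along addresses -/

namespace RegTree

variable {p : ℕ}

@[simp]
theorem region_nil (t : RegTree p) : t.region [] = Set.univ := by
  cases t <;> rfl

/-- The definition recurses from the root; peeling off the last turn instead relates a child to its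
parent, as every induction on depth below requires. -/
theorem region_append_singleton (t : RegTree p) (v : List Bool) (b : Bool) :
    t.region (v ++ [b]) = t.region v ∩ {x | ∃ j, t.splitVar v = some j ∧
      (if b then t.splitVal v < x j else x j ≤ t.splitVal v)} := by
  induction t generalizing v with
  | leaf c => cases v <;> simp [region, splitVar]
  | node j s l r ihl ihr =>
    rcases v with _ | ⟨a, v⟩
    · cases b <;> simp [region, splitVar, splitVal]
    · cases a <;> simp [region, splitVar, splitVal, ihl, ihr, Set.inter_assoc]

/-- The number of splits along variable `j` at the strict ancestors of the address `v`. -/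
def splitCount : RegTree p → Fin p → List Bool → ℕ
  | leaf _, _, _ => 0
  | node _ _ _ _, _, [] => 0
  | node i _ l _, j, false :: v => (if i = j then 1 else 0) + splitCount l j v
  | node i _ _ r, j, true :: v => (if i = j then 1 else 0) + splitCount r j v

@[simp]
theorem splitCount_nil (t : RegTree p) (j : Fin p) : t.splitCount j [] = 0 := by
  cases t <;> rfl

theorem splitCount_append_singleton (t : RegTree p) (j : Fin p) (v : List Bool) (b : Bool) :
    t.splitCount j (v ++ [b]) = t.splitCount j v + if t.splitVar v = some j then 1 else 0 := by
  induction t generalizing v with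
  | leaf c => simp [splitCount, splitVar]
  | node i s l r ihl ihr =>
    rcases v with _ | ⟨a, v⟩
    · cases b <;> simp [splitCount, splitVar]
    · cases a
      · rw [List.cons_append, splitCount, splitCount, ihl, add_assoc]
        rfl
      · rw [List.cons_append, splitCount, splitCount, ihr, add_assoc]
        rfl

theorem exists_mem_region (t : RegTree p) (k : ℕ) (hk : k ≤ t.minLeafDepth) (x : Fin p → ℝ) :
    ∃ v : List Bool, v.length = k ∧ x ∈ t.region v := by
  induction t generalizing k with
  | leaf c =>
    obtain rfl : k = 0 := by simpa [minLeafDepth] using hk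
    exact ⟨[], rfl, by simp⟩
  | node i s l r ihl ihr =>
    rcases k with _ | k
    · exact ⟨[], rfl, by simp⟩
    · simp only [minLeafDepth, add_le_add_iff_right, le_min_iff] at hk
      by_cases hx : x i ≤ s
      · obtain ⟨v, hv, hxv⟩ := ihl k hk.1
        exact ⟨false :: v, by simp [hv], hx, hxv⟩
      · obtain ⟨v, hv, hxv⟩ := ihr k hk.2
        exact ⟨true :: v, by simp [hv], lt_of_not_ge hx, hxv⟩

/-- Descending the tree only compares coordinates with split values, so points that no split
separates visit the same nodes. -/
theorem mem_region_of_forall_iff (t : RegTree p) (v : List Bool) {x y : Fin p → ℝ}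
    (hx : x ∈ t.region v) (hxy : ∀ i, ∀ s ∈ t.splitValues i, (y i ≤ s ↔ x i ≤ s)) :
    y ∈ t.region v := by
  induction t generalizing v with
  | leaf c => cases v <;> simp_all [region]
  | node i s l r ihl ihr =>
    have hl : ∀ k, ∀ s ∈ l.splitValues k, (y k ≤ s ↔ x k ≤ s) := fun k s' hs =>
      hxy k s' (by simp [splitValues, hs])
    have hr : ∀ k, ∀ s ∈ r.splitValues k, (y k ≤ s ↔ x k ≤ s) := fun k s' hs =>
      hxy k s' (by simp [splitValues, hs])
    have hi : y i ≤ s ↔ x i ≤ s := hxy i s (by simp [splitValues])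
    rcases v with _ | ⟨b, v⟩
    · simp
    · cases b
      · exact ⟨hi.2 hx.1, ihl v hx.2 hl⟩
      · exact ⟨lt_of_not_ge fun h => absurd (hi.1 h) (not_le.2 hx.1), ihr v hx.2 hr⟩

theorem measurable_splitVar (v : List Bool) :
    Measurable[_, ⊤] (fun t : RegTree p => t.splitVar v) :=
  Measurable.of_comap_le ((le_sup_left.trans le_sup_left).trans (le_iSup (fun v : List Bool =>
    MeasurableSpace.comap (fun t : RegTree p => splitVar t v) ⊤ ⊔
    MeasurableSpace.comap (fun t : RegTree p => splitVal t v) inferInstance ⊔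
    MeasurableSpace.comap (fun t : RegTree p => leafVal t v) inferInstance) v))

theorem measurable_splitVal (v : List Bool) :
    Measurable (fun t : RegTree p => t.splitVal v) :=
  Measurable.of_comap_le ((le_sup_right.trans le_sup_left).trans (le_iSup (fun v : List Bool =>
    MeasurableSpace.comap (fun t : RegTree p => splitVar t v) ⊤ ⊔
    MeasurableSpace.comap (fun t : RegTree p => splitVal t v) inferInstance ⊔
    MeasurableSpace.comap (fun t : RegTree p => leafVal t v) inferInstance) v))

end RegTree

/-! ### Many splits along every variable, by conditioning on the history -/

section History

variable {p : ℕ} {Ω : Type*}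

/-- The region and the split counts of a node are determined by the splits of its strict
ancestors. -/
theorem measurable_of_ancestors (H : MeasurableSpace Ω) (τ : Ω → RegTree p) (v : List Bool)
    (h1 : ∀ u, u <+: v ∧ u ≠ v → Measurable[H, ⊤] (fun ω => (τ ω).splitVar u))
    (h2 : ∀ u, u <+: v ∧ u ≠ v → Measurable[H] (fun ω => (τ ω).splitVal u))
    (x : Fin p → ℝ) (j : Fin p) :
    MeasurableSet[H] {ω | x ∈ (τ ω).region v} ∧ Measurable[H] (fun ω => (τ ω).splitCount j v) := by
  induction v using List.reverseRecOn with
  | nil => simp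
  | append_singleton v b ih =>
    have hv : v <+: v ++ [b] ∧ v ≠ v ++ [b] := ⟨List.prefix_append _ _, by simp⟩
    have hu : ∀ u, u <+: v ∧ u ≠ v → u <+: v ++ [b] ∧ u ≠ v ++ [b] := fun u hu =>
      ⟨hu.1.trans hv.1, fun h => by
        have h1 := hu.1.length_le
        rw [h] at h1
        simp at h1⟩
    obtain ⟨ih1, ih2⟩ := ih (fun u h => h1 u (hu u h)) (fun u h => h2 u (hu u h))
    have hvar : ∀ i, MeasurableSet[H] {ω | (τ ω).splitVar v = some i} := fun i =>
      h1 v hv (MeasurableSpace.measurableSet_top (s := {some i}))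
    have hval := h2 v hv
    constructor
    · simp only [RegTree.region_append_singleton]
      refine ih1.inter ?_
      have : {ω | x ∈ {x | ∃ j, (τ ω).splitVar v = some j ∧
          (if b then (τ ω).splitVal v < x j else x j ≤ (τ ω).splitVal v)}} =
          ⋃ i, {ω | (τ ω).splitVar v = some i} ∩
            {ω | if b then (τ ω).splitVal v < x i else x i ≤ (τ ω).splitVal v} := by
        ext ω; simp
      change MeasurableSet[H] {ω | x ∈ {x | ∃ j, (τ ω).splitVar v = some j ∧
          (if b then (τ ω).splitVal v < x j else x j ≤ (τ ω).splitVal v)}}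
      rw [this]
      refine MeasurableSet.iUnion fun i => (hvar i).inter ?_
      cases b
      · simp only [Bool.false_eq_true, if_false]
        exact hval (measurableSet_Ici (a := x i))
      · simp only [if_true]
        exact hval (measurableSet_Iio (a := x i))
    · simp only [RegTree.splitCount_append_singleton]
      exact ih2.add (Measurable.ite (hvar j) measurable_const measurable_const)

/-- The weight `2^{-N}` of a node containing `x`, for `N` the number of its ancestors split
along `j`, and zero for the other nodes. -/
noncomputable def nodeWeight (τ : Ω → RegTree p) (x : Fin p → ℝ) (j : Fin p) (v : List Bool)
    (ω : Ω) : ℝ :=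
  Set.indicator {ω | x ∈ (τ ω).region v} (fun ω => (1 / 2 : ℝ) ^ (τ ω).splitCount j v) ω

theorem nodeWeight_of_mem (τ : Ω → RegTree p) {x : Fin p → ℝ} (j : Fin p) {v : List Bool}
    {ω : Ω} (h : x ∈ (τ ω).region v) :
    nodeWeight τ x j v ω = (1 / 2 : ℝ) ^ (τ ω).splitCount j v :=
  Set.indicator_of_mem (s := {ω | x ∈ (τ ω).region v}) h _

theorem nodeWeight_of_notMem (τ : Ω → RegTree p) {x : Fin p → ℝ} (j : Fin p) {v : List Bool}
    {ω : Ω} (h : x ∉ (τ ω).region v) : nodeWeight τ x j v ω = 0 :=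
  Set.indicator_of_notMem (s := {ω | x ∈ (τ ω).region v}) h _

theorem nodeWeight_nonneg (τ : Ω → RegTree p) (x : Fin p → ℝ) (j : Fin p) (v : List Bool)
    (ω : Ω) : 0 ≤ nodeWeight τ x j v ω :=
  Set.indicator_nonneg (fun _ _ => by positivity) ω

theorem nodeWeight_le_one (τ : Ω → RegTree p) (x : Fin p → ℝ) (j : Fin p) (v : List Bool)
    (ω : Ω) : nodeWeight τ x j v ω ≤ 1 :=
  Set.indicator_le' (fun _ _ => pow_le_one₀ (by norm_num) (by norm_num)) (fun _ _ => by simp) ω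

/-- The weight involves strict ancestors only, so it is known before the node is split and factors
out of the conditional expectation. -/
theorem measurable_nodeWeight_history {D : MeasurableSpace Ω} {τ : Ω → RegTree p}
    (x : Fin p → ℝ) (j : Fin p) (v : List Bool) :
    Measurable[splitHistory D τ v] (nodeWeight τ x j v) := by
  have key : ∀ u, u <+: v ∧ u ≠ v →
      MeasurableSpace.comap (fun ω => (τ ω).splitVar u) ⊤ ⊔
        MeasurableSpace.comap (fun ω => (τ ω).splitVal u) inferInstance ≤
          splitHistory D τ v := fun u hu =>
    (le_iSup₂_of_le (f := fun (u : List Bool) (_ : u <+: v ∧ u ≠ v) =>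
      MeasurableSpace.comap (fun ω => (τ ω).splitVar u) ⊤ ⊔
        MeasurableSpace.comap (fun ω => (τ ω).splitVal u) inferInstance) u hu le_rfl).trans
      (le_sup_right.trans le_sup_left)
  obtain ⟨h1, h2⟩ := measurable_of_ancestors (splitHistory D τ v) τ v
    (fun u hu => Measurable.of_comap_le (le_sup_left.trans (key u hu)))
    (fun u hu => Measurable.of_comap_le (le_sup_right.trans (key u hu))) x j
  exact (measurable_from_top (f := fun n : ℕ => (1 / 2 : ℝ) ^ n)).comp h2 |>.indicator h1

/-- A point of a split node enters exactly one child, and its weight is halved exactly when the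
split is along `j`. If the node is not split, both children are empty. -/
theorem nodeWeight_children (τ : Ω → RegTree p) (x : Fin p → ℝ) (j : Fin p) (v : List Bool)
    (ω : Ω) : nodeWeight τ x j (v ++ [false]) ω + nodeWeight τ x j (v ++ [true]) ω =
      Set.indicator {ω | ((τ ω).splitVar v).isSome} (nodeWeight τ x j v) ω *
        (1 - 1 / 2 * Set.indicator {ω | (τ ω).splitVar v = some j} (fun _ => (1 : ℝ)) ω) := by
  by_cases hx : x ∈ (τ ω).region v
  · obtain h | ⟨i, h⟩ : (τ ω).splitVar v = none ∨ ∃ i, (τ ω).splitVar v = some i := by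
      cases (τ ω).splitVar v <;> simp
    · rw [nodeWeight_of_notMem, nodeWeight_of_notMem, Set.indicator_of_notMem]
      · simp
      · simp [h]
      · simp [RegTree.region_append_singleton, h]
      · simp [RegTree.region_append_singleton, h]
    · rw [Set.indicator_of_mem (show ω ∈ {ω | ((τ ω).splitVar v).isSome} by simp [h])]
      have hsum : nodeWeight τ x j (v ++ [false]) ω + nodeWeight τ x j (v ++ [true]) ω =
          (1 / 2) ^ ((τ ω).splitCount j v + if (τ ω).splitVar v = some j then 1 else 0) := by
        by_cases hs : x i ≤ (τ ω).splitVal v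
        · rw [nodeWeight_of_mem, nodeWeight_of_notMem, RegTree.splitCount_append_singleton,
            add_zero]
          · simp [RegTree.region_append_singleton, h, hs]
          · simp [RegTree.region_append_singleton, h, hx, hs]
        · rw [nodeWeight_of_notMem, nodeWeight_of_mem, RegTree.splitCount_append_singleton,
            zero_add]
          · simpa [RegTree.region_append_singleton, h, hx] using hs
          · simpa [RegTree.region_append_singleton, h, hx] using hs
      rw [hsum, nodeWeight_of_mem τ j hx, pow_add]
      by_cases hij : (τ ω).splitVar v = some j
      · rw [if_pos hij, Set.indicator_of_mem (show ω ∈ {ω | (τ ω).splitVar v = some j} from hij)]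
        norm_num
      · rw [if_neg hij,
          Set.indicator_of_notMem (show ω ∉ {ω | (τ ω).splitVar v = some j} from hij)]
        norm_num
  · rw [nodeWeight_of_notMem, nodeWeight_of_notMem, Set.indicator_apply_eq_zero.2, zero_mul,
      add_zero]
    · exact fun _ => nodeWeight_of_notMem τ j hx
    · simp [RegTree.region_append_singleton, hx]
    · simp [RegTree.region_append_singleton, hx]

variable {D : MeasurableSpace Ω} {τ : Ω → RegTree p} {π : ℝ} [mΩ : MeasurableSpace Ω]
  {P : Measure Ω} [IsProbabilityMeasure P]

theorem splitHistory_le (hD : D ≤ mΩ) (hτ : Measurable τ) (v : List Bool) :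
    splitHistory D τ v ≤ mΩ := by
  refine sup_le (sup_le hD (iSup_le fun u => iSup_le fun _ => sup_le ?_ ?_)) ?_
  · exact ((RegTree.measurable_splitVar u).comp hτ).comap_le
  · exact ((RegTree.measurable_splitVal u).comp hτ).comap_le
  · refine Measurable.comap_le ?_
    exact (measurable_from_top (f := fun o : Option (Fin p) => o.isSome)).comp
      ((RegTree.measurable_splitVar v).comp hτ)

theorem integrable_nodeWeight (hD : D ≤ mΩ) (hτ : Measurable τ) (x : Fin p → ℝ) (j : Fin p)
    (v : List Bool) : Integrable (nodeWeight τ x j v) P := by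
  refine Integrable.of_bound (((measurable_nodeWeight_history (D := D) x j v).mono
    (splitHistory_le hD hτ v) le_rfl).aestronglyMeasurable) 1 (Eventually.of_forall fun ω => ?_)
  rw [Real.norm_of_nonneg (nodeWeight_nonneg τ x j v ω)]
  exact nodeWeight_le_one τ x j v ω

/-- Given the history, a split along `j` has conditional probability at least `π` and halves the
weight, so the expected weight loses a factor `1 - π / 2`. The bound `π ≤ 1` keeps this factor
nonnegative. -/
theorem integral_nodeWeight_children_le (hD : D ≤ mΩ) (hτ : Measurable τ)
    (hr : RandomizedSplits P π D τ) (hπ1 : π ≤ 1) (x : Fin p → ℝ) (j : Fin p) (v : List Bool) :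
    ∫ ω, nodeWeight τ x j (v ++ [false]) ω ∂P + ∫ ω, nodeWeight τ x j (v ++ [true]) ω ∂P ≤
      (1 - π / 2) * ∫ ω, nodeWeight τ x j v ω ∂P := by
  have hH := splitHistory_le hD hτ v
  set V := Set.indicator {ω | ((τ ω).splitVar v).isSome} (nodeWeight τ x j v) with hV
  set e := Set.indicator {ω | (τ ω).splitVar v = some j} (fun _ => (1 : ℝ)) with he
  have hVm : Measurable[splitHistory D τ v] V := by
    refine (measurable_nodeWeight_history x j v).indicator ?_
    have h : Measurable[splitHistory D τ v, ⊤] (fun ω => ((τ ω).splitVar v).isSome) :=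
      Measurable.of_comap_le le_sup_right
    exact h (MeasurableSpace.measurableSet_top (s := {true}))
  have hV0 : ∀ ω, 0 ≤ V ω := fun ω => Set.indicator_nonneg (fun ω _ => nodeWeight_nonneg ..) ω
  have hVW : ∀ ω, V ω ≤ nodeWeight τ x j v ω := fun ω =>
    Set.indicator_le_self' (fun ω _ => nodeWeight_nonneg ..) ω
  have hVi : Integrable V P := (integrable_nodeWeight hD hτ x j v).mono'
    (hVm.mono hH le_rfl).aestronglyMeasurable (Eventually.of_forall fun ω => by
      rw [Real.norm_of_nonneg (hV0 ω)]; exact hVW ω)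
  have hem : Measurable e := measurable_const.indicator
    (((RegTree.measurable_splitVar v).comp hτ) (MeasurableSpace.measurableSet_top (s := {some j})))
  have he1 : ∀ ω, ‖e ω‖ ≤ 1 := fun ω => by
    simp only [he, Set.indicator]; split_ifs <;> simp
  have hei : Integrable e P :=
    Integrable.of_bound hem.aestronglyMeasurable 1 (Eventually.of_forall he1)
  have hVei : Integrable (V * e) P :=
    hVi.mul_bdd (c := 1) hem.aestronglyMeasurable (Eventually.of_forall he1)
  have hce : P[V * e | splitHistory D τ v] =ᵐ[P] V * P[e | splitHistory D τ v] :=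
    condExp_mul_of_stronglyMeasurable_left hVm.stronglyMeasurable hVei hei
  have hlow : π * ∫ ω, V ω ∂P ≤ ∫ ω, (V * e) ω ∂P := by
    rw [← integral_condExp hH (f := V * e), ← integral_const_mul]
    refine integral_mono_ae (hVi.const_mul π) integrable_condExp ?_
    filter_upwards [hce, hr v j] with ω h1 h2
    rw [h1, Pi.mul_apply, mul_comm]
    by_cases hs : ((τ ω).splitVar v).isSome
    · exact mul_le_mul_of_nonneg_left (h2 hs) (hV0 ω)
    · have hVω : V ω = 0 := by
        rw [hV, Set.indicator_of_notMem]
        exact hs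
      simp [hVω]
  have hsum : ∫ ω, nodeWeight τ x j (v ++ [false]) ω ∂P +
      ∫ ω, nodeWeight τ x j (v ++ [true]) ω ∂P =
      ∫ ω, V ω ∂P - 1 / 2 * ∫ ω, (V * e) ω ∂P := by
    rw [← integral_add (integrable_nodeWeight hD hτ x j _) (integrable_nodeWeight hD hτ x j _),
      ← integral_const_mul, ← integral_sub hVi (hVei.const_mul _)]
    refine integral_congr_ae (Eventually.of_forall fun ω => ?_)
    simp only [nodeWeight_children, Pi.mul_apply]
    ring
  have hle : ∫ ω, V ω ∂P ≤ ∫ ω, nodeWeight τ x j v ω ∂P :=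
    integral_mono hVi (integrable_nodeWeight hD hτ x j v) hVW
  have := mul_le_mul_of_nonneg_left hle (by linarith : 0 ≤ 1 - π / 2)
  rw [hsum]
  linarith

/-- The addresses of the nodes of depth `k`. -/
def addresses : ℕ → Finset (List Bool)
  | 0 => {[]}
  | k + 1 => (addresses k).biUnion fun v => {v ++ [false], v ++ [true]}

theorem mem_addresses (v : List Bool) : v ∈ addresses v.length := by
  induction v using List.reverseRecOn with
  | nil => simp [addresses]
  | append_singleton v b ih =>
    rw [List.length_append, List.length_singleton, addresses, Finset.mem_biUnion]
    exact ⟨v, ih, by cases b <;> simp⟩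

theorem sum_addresses_succ (k : ℕ) (w : List Bool → ℝ) :
    ∑ v ∈ addresses (k + 1), w v = ∑ v ∈ addresses k, (w (v ++ [false]) + w (v ++ [true])) := by
  rw [addresses, Finset.sum_biUnion]
  · exact Finset.sum_congr rfl fun v _ => Finset.sum_pair (by simp)
  · intro v _ v' _ hv
    rw [Function.onFun, Finset.disjoint_left]
    intro u hu hu'
    simp only [Finset.mem_insert, Finset.mem_singleton] at hu hu'
    apply hv
    rcases hu with rfl | rfl <;> rcases hu' with h | h <;> exact (List.append_inj' h rfl).1

theorem sum_integral_nodeWeight_le (hD : D ≤ mΩ) (hτ : Measurable τ)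
    (hr : RandomizedSplits P π D τ) (hπ1 : π ≤ 1) (x : Fin p → ℝ) (j : Fin p) (k : ℕ) :
    ∑ v ∈ addresses k, ∫ ω, nodeWeight τ x j v ω ∂P ≤ (1 - π / 2) ^ k := by
  induction k with
  | zero => simp [addresses, nodeWeight]
  | succ k ih =>
    rw [sum_addresses_succ]
    refine (Finset.sum_le_sum fun v _ =>
      integral_nodeWeight_children_le hD hτ hr hπ1 x j v).trans ?_
    rw [← Finset.mul_sum, pow_succ']
    exact mul_le_mul_of_nonneg_left ih (by linarith)

/-- With randomized splits, the node of depth `k` that contains `x` is unlikely to have few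
ancestors split along `j`. -/
theorem measure_splitCount_lt_le (hD : D ≤ mΩ) (hτ : Measurable τ)
    (hr : RandomizedSplits P π D τ) (hπ1 : π ≤ 1) (x : Fin p → ℝ) (j : Fin p) (k r : ℕ) :
    P {ω | ∃ v : List Bool, v.length = k ∧ x ∈ (τ ω).region v ∧ (τ ω).splitCount j v < r} ≤
      ENNReal.ofReal (2 ^ r * (1 - π / 2) ^ k) := by
  -- Markov's inequality: fewer than `r` splits along `j` make `2 ^ r` times the weight at least
  -- one.
  have hle : ∀ v, P {ω | x ∈ (τ ω).region v ∧ (τ ω).splitCount j v < r} ≤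
      ENNReal.ofReal (2 ^ r * ∫ ω, nodeWeight τ x j v ω ∂P) := by
    intro v
    have hi := (integrable_nodeWeight (P := P) hD hτ x j v).const_mul (2 ^ r)
    rw [← integral_const_mul, ofReal_integral_eq_lintegral_ofReal hi
      (Eventually.of_forall fun ω => mul_nonneg (by positivity) (nodeWeight_nonneg ..))]
    refine le_trans (measure_mono ?_) (meas_ge_le_lintegral_div (μ := P) (ε := 1)
      hi.aestronglyMeasurable.aemeasurable.ennreal_ofReal one_ne_zero ENNReal.one_ne_top |>.trans_eq
        (div_one _))
    rintro ω ⟨h1, h2⟩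
    show 1 ≤ ENNReal.ofReal (2 ^ r * nodeWeight τ x j v ω)
    rw [ENNReal.one_le_ofReal, nodeWeight_of_mem τ j h1, one_div, inv_pow,
      ← div_eq_mul_inv, one_le_div (by positivity)]
    exact pow_le_pow_right₀ (by norm_num) h2.le
  calc _ ≤ P (⋃ v ∈ addresses k, {ω | x ∈ (τ ω).region v ∧ (τ ω).splitCount j v < r}) := by
        refine measure_mono ?_
        rintro ω ⟨v, rfl, h⟩
        exact Set.mem_biUnion (mem_addresses v) h
    _ ≤ ∑ v ∈ addresses k, P {ω | x ∈ (τ ω).region v ∧ (τ ω).splitCount j v < r} :=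
        measure_biUnion_finset_le _ _
    _ ≤ ∑ v ∈ addresses k, ENNReal.ofReal (2 ^ r * ∫ ω, nodeWeight τ x j v ω ∂P) :=
        Finset.sum_le_sum fun v _ => hle v
    _ = ENNReal.ofReal (2 ^ r * ∑ v ∈ addresses k, ∫ ω, nodeWeight τ x j v ω ∂P) := by
        rw [Finset.mul_sum, ENNReal.ofReal_sum_of_nonneg]
        exact fun v _ => mul_nonneg (by positivity)
          (integral_nonneg fun ω => nodeWeight_nonneg ..)
    _ ≤ _ := ENNReal.ofReal_le_ofReal (mul_le_mul_of_nonneg_left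
        (sum_integral_nodeWeight_le hD hτ hr hπ1 x j k) (by positivity))

end History

/-! ### A uniform law of large numbers over boxes -/

section Boxes

variable {p : ℕ}

/-- The half-open box with corners `a` and `b`. -/
def box (a b : Fin p → ℝ) : Set (Fin p → ℝ) := Set.univ.pi fun i => Set.Ioc (a i) (b i)

theorem mem_box {a b x : Fin p → ℝ} : x ∈ box a b ↔ ∀ i, a i < x i ∧ x i ≤ b i := by
  simp [box]

theorem measurableSet_box (a b : Fin p → ℝ) : MeasurableSet (box a b) :=
  MeasurableSet.univ_pi fun _ => measurableSet_Ioc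

theorem box_subset_box {a b a' b' : Fin p → ℝ} (ha : a' ≤ a) (hb : b ≤ b') :
    box a b ⊆ box a' b' := fun _ hx => mem_box.2 fun i =>
  ⟨(ha i).trans_lt (mem_box.1 hx i).1, (mem_box.1 hx i).2.trans (hb i)⟩

theorem cubeMeasure_real_box {a b : Fin p → ℝ} (h0 : 0 ≤ a) (hab : a ≤ b) (h1 : b ≤ 1) :
    (cubeMeasure p).real (box a b) = ∏ i, (b i - a i) := by
  have hsub : box a b ⊆ Set.Icc 0 1 := fun x hx =>
    ⟨fun i => (h0 i).trans (mem_box.1 hx i).1.le, fun i => (mem_box.1 hx i).2.trans (h1 i)⟩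
  rw [measureReal_def, cubeMeasure, Measure.restrict_eq_self _ hsub, box, Real.volume_pi_Ioc,
    ENNReal.toReal_prod]
  exact Finset.prod_congr rfl fun i _ => ENNReal.toReal_ofReal (sub_nonneg.2 (hab i))

theorem cubeMeasure_real_slab_le (i : Fin p) {u w : ℝ} (h : u ≤ w) :
    (cubeMeasure p).real {x | u < x i ∧ x i ≤ w} ≤ w - u := by
  have e : {x : Fin p → ℝ | u < x i ∧ x i ≤ w} = Function.eval i ⁻¹' (Set.Ioc u w) := rfl
  have hmp := measurePreserving_eval
    (fun _ : Fin p => (volume : Measure ℝ).restrict (Set.Icc (0 : ℝ) 1)) i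
  rw [e, measureReal_def, cubeMeasure_eq_pi,
    hmp.measure_preimage measurableSet_Ioc.nullMeasurableSet]
  refine ENNReal.toReal_le_of_le_ofReal (sub_nonneg.2 h) ?_
  refine (Measure.restrict_apply_le _ _).trans ?_
  rw [Real.volume_Ioc]

variable {f : (Fin p → ℝ) → ℝ} {c₁ c₂ : ℝ}

theorem inputLaw_real_le (hc₂ : 0 ≤ c₂) [IsFiniteMeasure (inputLaw f)]
    (hf : ∀ x, f x ≤ c₂) (s : Set (Fin p → ℝ)) :
    (inputLaw f).real s ≤ c₂ * (cubeMeasure p).real s := by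
  have h := ENNReal.toReal_mono
    (ENNReal.mul_ne_top ENNReal.ofReal_ne_top (measure_ne_top _ _)) (inputLaw_le hf s)
  simpa [measureReal_def, ENNReal.toReal_ofReal hc₂] using h

theorem le_inputLaw_real (hc₁ : 0 < c₁) [IsFiniteMeasure (inputLaw f)]
    (hf : ∀ x, c₁ ≤ f x) (s : Set (Fin p → ℝ)) :
    c₁ * (cubeMeasure p).real s ≤ (inputLaw f).real s := by
  have h0 : ENNReal.ofReal c₁ ≠ 0 := by simpa using hc₁
  have h := ENNReal.toReal_mono
    (ENNReal.mul_ne_top (ENNReal.inv_ne_top.2 h0) (measure_ne_top _ _)) (cubeMeasure_le hc₁ hf s)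
  simp only [ENNReal.toReal_mul, ENNReal.toReal_inv,
    ENNReal.toReal_ofReal hc₁.le] at h
  rw [measureReal_def, measureReal_def]
  calc _ ≤ c₁ * (c₁⁻¹ * (inputLaw f s).toReal) := by gcongr
    _ = _ := by field_simp

/-- The number of the first `n` terms of `X` that lie in `S`. -/
noncomputable def obsCount (n : ℕ) (X : ℕ → Fin p → ℝ) (S : Set (Fin p → ℝ)) : ℝ :=
  (Set.ncard {i | i < n ∧ X i ∈ S} : ℝ)

theorem obsCount_mono_of (n : ℕ) {X : ℕ → Fin p → ℝ} {S S' : Set (Fin p → ℝ)}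
    (h : ∀ i, X i ∈ S → X i ∈ S') : obsCount n X S ≤ obsCount n X S' := by
  refine Nat.cast_le.2 (Set.ncard_le_ncard (fun i hi => ⟨hi.1, h i hi.2⟩) ?_)
  exact (Set.finite_Iio n).subset fun i hi => hi.1

theorem obsCount_eq_sum (n : ℕ) (X : ℕ → Fin p → ℝ) (S : Set (Fin p → ℝ)) :
    obsCount n X S = ∑ i ∈ Finset.range n, S.indicator (fun _ => (1 : ℝ)) (X i) := by
  classical
  have : {i | i < n ∧ X i ∈ S} = ((Finset.range n).filter fun i => X i ∈ S : Finset ℕ) := by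
    ext i; simp
  rw [obsCount, this, Set.ncard_coe_finset, Finset.card_filter]
  push_cast
  exact Finset.sum_congr rfl fun i _ => by simp [Set.indicator]

/-- The empirical frequencies of all boxes are close to their probabilities. -/
def UniformlyClose (μ : Measure (Fin p → ℝ)) (ε : ℝ) (n : ℕ) (X : ℕ → Fin p → ℝ) : Prop :=
  ∀ a b : Fin p → ℝ, a ∈ Set.Icc (0 : Fin p → ℝ) 1 → b ∈ Set.Icc (0 : Fin p → ℝ) 1 →
    |obsCount n X (box a b) - n * μ.real (box a b)| ≤ ε * n

/-- A grid of boxes suffices to control all boxes. -/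
theorem uniformlyClose_of_grid [IsFiniteMeasure (inputLaw f)] (hc₂ : 0 ≤ c₂)
    (hf : ∀ x, f x ≤ c₂) {ε : ℝ} {N : ℕ} (hN : 0 < N) (hNε : 2 * p * c₂ / N ≤ ε / 2) {n : ℕ}
    {X : ℕ → Fin p → ℝ}
    (hgrid : ∀ a b : Fin p → Fin (N + 1),
      |obsCount n X (box (fun i => (a i : ℝ) / N) (fun i => (b i : ℝ) / N)) -
        n * (inputLaw f).real (box (fun i => (a i : ℝ) / N) (fun i => (b i : ℝ) / N))| ≤
          ε / 2 * n) :
    UniformlyClose (inputLaw f) ε n X := by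
  intro a b ha hb
  have hN' : (0 : ℝ) < N := by exact_mod_cast hN
  have hfl : ∀ c ∈ Set.Icc (0 : Fin p → ℝ) 1, ∃ l u : Fin p → Fin (N + 1),
      (∀ i, ((l i : ℕ) : ℝ) / N ≤ c i) ∧ (∀ i, c i ≤ ((u i : ℕ) : ℝ) / N) ∧
        ∀ i, ((u i : ℕ) : ℝ) / N - ((l i : ℕ) : ℝ) / N ≤ 1 / N := by
    intro c hc
    have hc0 : ∀ i, 0 ≤ c i * N := fun i => mul_nonneg (hc.1 i) hN'.le
    have hc1 : ∀ i, c i * N ≤ N := fun i => mul_le_of_le_one_left hN'.le (hc.2 i)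
    refine ⟨fun i => ⟨⌊c i * N⌋₊, Nat.lt_succ_of_le (Nat.floor_le_of_le (hc1 i))⟩,
      fun i => ⟨⌈c i * N⌉₊, Nat.lt_succ_of_le (Nat.ceil_le.2 (hc1 i))⟩, fun i => ?_, fun i => ?_,
      fun i => ?_⟩
    · rw [div_le_iff₀ hN']; exact Nat.floor_le (hc0 i)
    · rw [le_div_iff₀ hN']; exact Nat.le_ceil _
    · rw [← sub_div]
      refine div_le_div_of_nonneg_right ?_ hN'.le
      have : (⌈c i * N⌉₊ : ℝ) ≤ (⌊c i * N⌋₊ : ℝ) + 1 := by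
        exact_mod_cast Nat.ceil_le_floor_add_one (c i * N)
      simp only
      linarith
  obtain ⟨la, ua, hla, hua, hda⟩ := hfl a ha
  obtain ⟨lb, ub, hlb, hub, hdb⟩ := hfl b hb
  -- Rounding the corners inward and outward to the grid sandwiches the box. The inner corners may
  -- cross, in which case the inner box is empty and the argument is unaffected.
  set inner := box (fun i => ((ua i : ℕ) : ℝ) / N) (fun i => ((lb i : ℕ) : ℝ) / N) with hinner
  set outer := box (fun i => ((la i : ℕ) : ℝ) / N) (fun i => ((ub i : ℕ) : ℝ) / N) with houter
  have h1 : inner ⊆ box a b := box_subset_box hua hlb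
  have h2 : box a b ⊆ outer := box_subset_box hla hub
  have hgap : (inputLaw f).real outer - (inputLaw f).real inner ≤ ε / 2 := by
    refine le_trans ?_ hNε
    -- A point of the outer box that misses the inner one lies in one of `2 * p` coordinate slabs of
    -- width at most `1 / N`, each of probability at most `c₂ / N`.
    have hsub : outer ⊆ inner ∪ ⋃ i ∈ (Finset.univ : Finset (Fin p)),
        ({x | ((la i : ℕ) : ℝ) / N < x i ∧ x i ≤ ((ua i : ℕ) : ℝ) / N} ∪
          {x | ((lb i : ℕ) : ℝ) / N < x i ∧ x i ≤ ((ub i : ℕ) : ℝ) / N}) := by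
      intro x hx
      by_contra hcon
      simp only [Set.mem_union, Set.mem_iUnion, not_or, not_exists, Set.mem_ofPred_eq,
        Finset.mem_univ, not_and, true_implies, not_le] at hcon
      refine hcon.1 (mem_box.2 fun i => ⟨(hcon.2 i).1 (mem_box.1 hx i).1, ?_⟩)
      by_contra hlt
      exact absurd ((hcon.2 i).2 (not_le.1 hlt)) (not_lt.2 (mem_box.1 hx i).2)
    have hle := (measureReal_mono (μ := inputLaw f) hsub (measure_ne_top _ _)).trans
      (measureReal_union_le _ _)
    have hslab : ∀ i : Fin p, ∀ u w : ℝ, u ≤ w → w - u ≤ 1 / N →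
        (inputLaw f).real {x | u < x i ∧ x i ≤ w} ≤ c₂ * (1 / N) := fun i u w huw hd =>
      (inputLaw_real_le hc₂ hf _).trans
        (mul_le_mul_of_nonneg_left ((cubeMeasure_real_slab_le i huw).trans hd) hc₂)
    have hU : (inputLaw f).real (⋃ i ∈ (Finset.univ : Finset (Fin p)),
        ({x | ((la i : ℕ) : ℝ) / N < x i ∧ x i ≤ ((ua i : ℕ) : ℝ) / N} ∪
          {x | ((lb i : ℕ) : ℝ) / N < x i ∧ x i ≤ ((ub i : ℕ) : ℝ) / N})) ≤
        ∑ i : Fin p, (c₂ * (1 / N) + c₂ * (1 / N)) := by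
      refine (measureReal_biUnion_finset_le _ _).trans (Finset.sum_le_sum fun i _ => ?_)
      refine (measureReal_union_le _ _).trans (add_le_add ?_ ?_)
      · exact hslab i _ _ ((hla i).trans (hua i)) (hda i)
      · exact hslab i _ _ ((hlb i).trans (hub i)) (hdb i)
    simp only [Finset.sum_const, Finset.card_univ, Fintype.card_fin, nsmul_eq_mul] at hU
    have : (p : ℝ) * (c₂ * (1 / N) + c₂ * (1 / N)) = 2 * p * c₂ / N := by ring
    linarith
  have hn : (0 : ℝ) ≤ n := Nat.cast_nonneg n
  have h3 := obsCount_mono_of n (X := X) fun i h => h1 h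
  have h4 := obsCount_mono_of n (X := X) fun i h => h2 h
  have h5 := abs_le.1 (hgrid ua lb)
  have h6 := abs_le.1 (hgrid la ub)
  have h7 := measureReal_mono (μ := inputLaw f) h1 (measure_ne_top _ _)
  have h8 := measureReal_mono (μ := inputLaw f) h2 (measure_ne_top _ _)
  have h9 : n * (inputLaw f).real outer ≤ n * (inputLaw f).real (box a b) + ε / 2 * n := by
    nlinarith
  have h10 : n * (inputLaw f).real (box a b) ≤ n * (inputLaw f).real inner + ε / 2 * n := by
    nlinarith
  rw [abs_le]
  constructor <;> linarith [h5.1, h5.2, h6.1, h6.2]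

variable {Ω : Type*} [MeasurableSpace Ω] {P : Measure Ω} [IsProbabilityMeasure P]
  {X : ℕ → Ω → Fin p → ℝ}

/-- The strong law for the indicators of `S` gives almost sure convergence of the frequencies, hence
convergence in probability; pairwise independence is enough. -/
theorem tendsto_measure_obsCount {μ : Measure (Fin p → ℝ)} (hX : ∀ i, Measurable (X i))
    (hXlaw : ∀ i, P.map (X i) = μ) (hindep : Pairwise fun i j => IndepFun (X i) (X j) P)
    {S : Set (Fin p → ℝ)} (hS : MeasurableSet S) {ε : ℝ} (hε : 0 < ε) :
    Tendsto (fun n : ℕ => P {ω | ε * n < |obsCount n (fun i => X i ω) S - n * μ.real S|}) atTop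
      (𝓝 0) := by
  set φ : (Fin p → ℝ) → ℝ := S.indicator (fun _ => (1 : ℝ)) with hφ
  have hφm : Measurable φ := measurable_const.indicator hS
  have hZm : ∀ i, Measurable fun ω => φ (X i ω) := fun i => hφm.comp (hX i)
  have hEq : ∫ ω, φ (X 0 ω) ∂P = μ.real S := by
    rw [← integral_map (hX 0).aemeasurable (f := φ) hφm.aestronglyMeasurable, hXlaw 0, hφ,
      integral_indicator hS]
    simp
  have hslln := strong_law_ae_real (μ := P) (fun i ω => φ (X i ω))
    (Integrable.of_bound (hZm 0).aestronglyMeasurable 1 (Eventually.of_forall fun ω => by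
      simp only [hφ, Set.indicator]; split_ifs <;> simp))
    (fun i j hij => (hindep hij).comp hφm hφm)
    (fun i => (IdentDistrib.mk (hX i).aemeasurable (hX 0).aemeasurable
      ((hXlaw i).trans (hXlaw 0).symm)).comp hφm)
  rw [hEq] at hslln
  have hmeas := tendstoInMeasure_of_tendsto_ae (μ := P) (fun n =>
    ((Finset.measurable_sum (Finset.range n) fun i _ => hZm i).div_const
      (n : ℝ)).aestronglyMeasurable) hslln
  rw [tendstoInMeasure_iff_dist] at hmeas
  refine tendsto_of_tendsto_of_tendsto_of_le_of_le tendsto_const_nhds (hmeas ε hε)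
    (fun n => zero_le) fun n => measure_mono fun ω hω => ?_
  have hω : ε * n < |obsCount n (fun i => X i ω) S - n * μ.real S| := hω
  rw [obsCount_eq_sum] at hω
  rcases Nat.eq_zero_or_pos n with rfl | hn
  · simp at hω
  · have hn' : (0 : ℝ) < n := by exact_mod_cast hn
    show ε ≤ dist ((∑ i ∈ Finset.range n, φ (X i ω)) / n) (μ.real S)
    rw [Real.dist_eq, div_sub' hn'.ne', abs_div, abs_of_pos hn', le_div_iff₀ hn']
    exact hω.le

/-- Uniform law of large numbers over boxes, in probability. -/
theorem tendsto_measure_not_uniformlyClose [IsFiniteMeasure (inputLaw f)] (hc₂ : 0 ≤ c₂)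
    (hf : ∀ x, f x ≤ c₂) (hX : ∀ i, Measurable (X i)) (hXlaw : ∀ i, P.map (X i) = inputLaw f)
    (hindep : Pairwise fun i j => IndepFun (X i) (X j) P) {ε : ℝ} (hε : 0 < ε) :
    Tendsto (fun n : ℕ => P {ω | ¬ UniformlyClose (inputLaw f) ε n (fun i => X i ω)}) atTop
      (𝓝 0) := by
  -- The grid is so fine that rounding a box costs at most `ε / 2` in probability; the other half is
  -- left for the finitely many grid boxes.
  obtain ⟨N, hN⟩ := exists_nat_gt (2 * p * c₂ / (ε / 2))
  have hN0 : (0 : ℝ) < N := lt_of_le_of_lt (by positivity) hN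
  have hNε : 2 * p * c₂ / N ≤ ε / 2 := by
    rw [div_lt_iff₀ (by positivity)] at hN
    rw [div_le_iff₀ hN0]
    linarith
  have hsum : Tendsto (fun n : ℕ => ∑ ab : (Fin p → Fin (N + 1)) × (Fin p → Fin (N + 1)),
      P {ω | ε / 2 * n < |obsCount n (fun i => X i ω)
          (box (fun i => (ab.1 i : ℝ) / N) (fun i => (ab.2 i : ℝ) / N)) -
        n * (inputLaw f).real (box (fun i => (ab.1 i : ℝ) / N) (fun i => (ab.2 i : ℝ) / N))|})
      atTop (𝓝 0) := by
    have := tendsto_finsetSum (Finset.univ : Finset ((Fin p → Fin (N + 1)) × (Fin p → Fin (N + 1))))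
      fun ab _ => tendsto_measure_obsCount hX hXlaw hindep
        (measurableSet_box (fun i => (ab.1 i : ℝ) / N) (fun i => (ab.2 i : ℝ) / N))
        (half_pos hε)
    simpa using this
  refine tendsto_of_tendsto_of_tendsto_of_le_of_le tendsto_const_nhds hsum
    (fun n => zero_le) fun n => le_trans (measure_mono fun ω hω => ?_)
      (measure_biUnion_finset_le _ _)
  by_contra hcon
  refine hω (uniformlyClose_of_grid hc₂ hf (by exact_mod_cast hN0) hNε fun a b => ?_)
  simp only [Set.mem_iUnion, not_exists, Finset.mem_univ, true_implies, Set.mem_ofPred_eq,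
    not_lt] at hcon
  exact hcon (a, b)

end Boxes

/-! ### Geometric shrinking of the nodes of balanced trees -/

section Mesh

variable {p : ℕ} {f : (Fin p → ℝ) → ℝ} {c₁ c₂ : ℝ}

/-- Of two boxes that differ in direction `i` only, the ratio of the sides is controlled by the
ratio of the probabilities. -/
theorem side_le_of_measure_le [IsFiniteMeasure (inputLaw f)] (hc₁ : 0 < c₁)
    (hf : ∀ x, c₁ ≤ f x ∧ f x ≤ c₂) {a b a' b' : Fin p → ℝ} (h0 : 0 ≤ a) (hab : a ≤ b)
    (h1 : b ≤ 1) (h0' : 0 ≤ a') (hab' : a' ≤ b') (h1' : b' ≤ 1) (i : Fin p)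
    (ha : ∀ j, j ≠ i → a' j = a j) (hb : ∀ j, j ≠ i → b' j = b j) {θ : ℝ} (hθ : 0 ≤ θ)
    (hpos : 0 < (inputLaw f).real (box a b))
    (hle : θ * (inputLaw f).real (box a b) ≤ (inputLaw f).real (box a' b')) :
    θ * c₁ / c₂ * (b i - a i) ≤ b' i - a' i := by
  have hc₂ : 0 < c₂ := hc₁.trans_le ((hf 0).1.trans (hf 0).2)
  -- The product of the common sides cancels from the comparison of volumes; it is positive because
  -- the larger box has positive probability.
  set Q := ∏ j ∈ Finset.univ.erase i, (b j - a j) with hQ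
  have e1 : (cubeMeasure p).real (box a b) = (b i - a i) * Q := by
    rw [cubeMeasure_real_box h0 hab h1, hQ,
      Finset.mul_prod_erase Finset.univ (fun j => b j - a j) (Finset.mem_univ i)]
  have e2 : (cubeMeasure p).real (box a' b') = (b' i - a' i) * Q := by
    rw [cubeMeasure_real_box h0' hab' h1', hQ, ← Finset.mul_prod_erase _ _ (Finset.mem_univ i)]
    congr 1
    refine Finset.prod_congr rfl fun j hj => ?_
    rw [ha j (Finset.ne_of_mem_erase hj), hb j (Finset.ne_of_mem_erase hj)]
  have hQ0 : 0 ≤ Q := Finset.prod_nonneg fun j _ => sub_nonneg.2 (hab j)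
  have h2 := inputLaw_real_le hc₂.le (fun x => (hf x).2) (box a b)
  have h3 := inputLaw_real_le hc₂.le (fun x => (hf x).2) (box a' b')
  have h4 := le_inputLaw_real hc₁ (fun x => (hf x).1) (box a b)
  rw [e1] at h2 h4
  rw [e2] at h3
  have hQpos : 0 < Q := by
    refine hQ0.lt_of_ne fun h => ?_
    rw [← h] at h2
    simp at h2
    linarith
  have h5 : θ * (c₁ * ((b i - a i) * Q)) ≤ c₂ * ((b' i - a' i) * Q) :=
    (mul_le_mul_of_nonneg_left h4 hθ).trans (hle.trans h3)
  have h6 : (θ * c₁ * (b i - a i)) * Q ≤ (c₂ * (b' i - a' i)) * Q := by linarith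
  have h7 := le_of_mul_le_mul_right h6 hQpos
  rw [div_mul_eq_mul_div, div_le_iff₀ hc₂]
  linarith

theorem box_inter_le {a b : Fin p → ℝ} {i : Fin p} {s : ℝ} (hs : s ≤ b i) :
    box a b ∩ {x | x i ≤ s} = box a (Function.update b i s) := by
  ext x
  simp only [Set.mem_inter_iff, mem_box, Set.mem_ofPred_eq]
  constructor
  · rintro ⟨h1, h2⟩ j
    rcases eq_or_ne j i with rfl | hj
    · simpa using ⟨(h1 j).1, h2⟩
    · simpa [hj] using h1 j
  · intro h
    have hi := h i
    rw [Function.update_self] at hi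
    refine ⟨fun j => ?_, hi.2⟩
    rcases eq_or_ne j i with rfl | hj
    · exact ⟨hi.1, hi.2.trans hs⟩
    · simpa [hj] using h j

theorem box_inter_lt {a b : Fin p → ℝ} {i : Fin p} {s : ℝ} (hs : a i ≤ s) :
    box a b ∩ {x | s < x i} = box (Function.update a i s) b := by
  ext x
  simp only [Set.mem_inter_iff, mem_box, Set.mem_ofPred_eq]
  constructor
  · rintro ⟨h1, h2⟩ j
    rcases eq_or_ne j i with rfl | hj
    · simpa using ⟨h2, (h1 j).2⟩
    · simpa [hj] using h1 j
  · intro h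
    have hi := h i
    rw [Function.update_self] at hi
    refine ⟨fun j => ?_, hi.1⟩
    rcases eq_or_ne j i with rfl | hj
    · exact ⟨hs.trans_lt hi.1, hi.2⟩
    · simpa [hj] using h j

theorem exists_mem_of_obsCount_pos {n : ℕ} {X : ℕ → Fin p → ℝ} {S : Set (Fin p → ℝ)}
    (h : 0 < obsCount n X S) : ∃ i, X i ∈ S := by
  by_contra! hcon
  have : {i | i < n ∧ X i ∈ S} = ∅ := by
    ext i; simp [hcon i]
  rw [obsCount, this] at h
  simp at h

/-- In a balanced tree whose observations are uniformly close to the input law, the sides of the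
nodes shrink geometrically with the number of splits. -/
theorem exists_box_of_isBalanced [IsProbabilityMeasure (inputLaw f)] (hc₁ : 0 < c₁)
    (hf : ∀ x, c₁ ≤ f x ∧ f x ≤ c₂) {γ : ℝ} (hγ : 0 < γ) (hγ1 : γ ≤ 1) {n k : ℕ} (hn : 0 < n)
    {X : ℕ → Fin p → ℝ} (hX : ∀ i, X i ∈ box (0 : Fin p → ℝ) 1) {t : RegTree p}
    (hbal : t.IsBalanced γ n X) (hclose : UniformlyClose (inputLaw f) (γ ^ (k + 1) / 8) n X)
    (j : Fin p) (v : List Bool) (hv : v.length ≤ k) (hne : (t.region v).Nonempty) :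
    ∃ a b : Fin p → ℝ, 0 ≤ a ∧ a ≤ b ∧ b ≤ 1 ∧ t.region v ∩ box 0 1 = box a b ∧
      γ ^ v.length * n ≤ obsCount n X (t.region v) ∧
      b j - a j ≤ (1 - γ / 2 * c₁ / c₂) ^ t.splitCount j v := by
  have hn' : (0 : ℝ) < n := by exact_mod_cast hn
  have hc₂ : 0 < c₂ := hc₁.trans_le ((hf 0).1.trans (hf 0).2)
  have hκ : 0 ≤ 1 - γ / 2 * c₁ / c₂ := by
    rw [sub_nonneg, div_le_one hc₂]
    have := (hf 0).1.trans (hf 0).2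
    nlinarith
  induction v using List.reverseRecOn with
  | nil =>
    refine ⟨0, 1, le_rfl, zero_le_one, le_rfl, by simp, ?_, by simp⟩
    simp only [RegTree.region_nil, List.length_nil, pow_zero, one_mul, obsCount, Set.mem_univ,
      and_true]
    have : {i | i < n} = (Finset.range n : Set ℕ) := by ext; simp
    rw [this, Set.ncard_coe_finset, Finset.card_range]
  | append_singleton v c ih =>
    have hlen : v.length < k := by simpa using hv
    obtain ⟨x₀, hx₀⟩ := hne
    rw [RegTree.region_append_singleton] at hx₀
    obtain ⟨a, b, h0, hab, h1, hbox, hcount, hside⟩ := ih hlen.le ⟨x₀, hx₀.1⟩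
    obtain ⟨i, hi, -⟩ := hx₀.2
    set s := t.splitVal v with hs
    have hreg : ∀ d : Bool, t.region (v ++ [d]) =
        t.region v ∩ {x | if d then s < x i else x i ≤ s} := fun d => by
      rw [RegTree.region_append_singleton]
      simp [hi, ← hs]
    have hbal' : ∀ d : Bool, γ * obsCount n X (t.region v) ≤ obsCount n X (t.region (v ++ [d])) :=
      fun d => hbal v (by simp [hi]) d
    have hcpos : 0 < obsCount n X (t.region v) := lt_of_lt_of_le (by positivity) hcount
    -- Balance puts an observation into each child, so the split value lies strictly inside the side
    -- of the box.
    have hcd : ∀ d : Bool, ∃ q, X q ∈ box a b ∧ (if d then s < X q i else X q i ≤ s) := fun d => by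
      obtain ⟨q, hq⟩ := exists_mem_of_obsCount_pos (lt_of_lt_of_le (by positivity) (hbal' d))
      rw [hreg] at hq
      exact ⟨q, hbox ▸ ⟨hq.1, hX q⟩, hq.2⟩
    have has : a i < s := by
      obtain ⟨q, hq, hqs⟩ := hcd false
      exact (mem_box.1 hq i).1.trans_le (by simpa using hqs)
    have hsb : s < b i := by
      obtain ⟨q, hq, hqs⟩ := hcd true
      exact lt_of_lt_of_le (by simpa using hqs) (mem_box.1 hq i).2
    let lo : Bool → Fin p → ℝ := fun d => if d then Function.update a i s else a
    let hi' : Bool → Fin p → ℝ := fun d => if d then b else Function.update b i s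
    have hlo0 : ∀ d, 0 ≤ lo d := fun d => by
      cases d
      · exact h0
      · exact le_update_iff.2 ⟨(h0 i).trans has.le, fun q _ => h0 q⟩
    have hhi1 : ∀ d, hi' d ≤ 1 := fun d => by
      cases d
      · exact update_le_iff.2 ⟨hsb.le.trans (h1 i), fun q _ => h1 q⟩
      · exact h1
    have hlohi : ∀ d, lo d ≤ hi' d := fun d => by
      cases d
      · exact le_update_iff.2 ⟨has.le, fun q _ => hab q⟩
      · exact update_le_iff.2 ⟨hsb.le, fun q _ => hab q⟩
    have hlo_ne : ∀ d q, q ≠ i → lo d q = a q := fun d q hq => by cases d <;> simp [lo, hq]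
    have hhi_ne : ∀ d q, q ≠ i → hi' d q = b q := fun d q hq => by cases d <;> simp [hi', hq]
    have hboxd : ∀ d, t.region (v ++ [d]) ∩ box 0 1 = box (lo d) (hi' d) := fun d => by
      rw [hreg, Set.inter_right_comm, hbox]
      cases d
      · simpa [lo, hi'] using box_inter_le hsb.le
      · simpa [lo, hi'] using box_inter_lt has.le
    have hmemIcc : ∀ w : Fin p → ℝ, 0 ≤ w → w ≤ 1 → w ∈ Set.Icc (0 : Fin p → ℝ) 1 :=
      fun w h h' => ⟨h, h'⟩
    have hcl := hclose a b (hmemIcc a h0 (hab.trans h1)) (hmemIcc b (h0.trans hab) h1)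
    have hcountbox : obsCount n X (box a b) = obsCount n X (t.region v) := by
      refine le_antisymm (obsCount_mono_of n fun q hq => ?_) (obsCount_mono_of n fun q hq => ?_)
      · rw [← hbox] at hq; exact hq.1
      · rw [← hbox]; exact ⟨hq, hX q⟩
    have hcountd : ∀ d, obsCount n X (t.region (v ++ [d])) ≤
        obsCount n X (box (lo d) (hi' d)) := fun d =>
      obsCount_mono_of n fun q hq => by rw [← hboxd]; exact ⟨hq, hX q⟩
    set μab := (inputLaw f).real (box a b) with hμab
    have hγk : 0 < γ ^ k := by positivity
    have hpow : γ ^ k ≤ γ ^ v.length := pow_le_pow_of_le_one hγ.le hγ1 hlen.le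
    have hεk : γ ^ (k + 1) / 8 ≤ γ ^ k / 8 := by
      rw [pow_succ]; nlinarith
    -- At depth below `k` the node holds at least the fraction `γ ^ k` of the observations, and the
    -- tolerance `γ ^ (k + 1) / 8` is less than half of it.
    have hμlow : γ ^ k / 2 ≤ μab := by
      rw [hcountbox] at hcl
      have h := (abs_le.1 hcl).2
      have h' : γ ^ k * n ≤ obsCount n X (t.region v) :=
        (mul_le_mul_of_nonneg_right hpow hn'.le).trans hcount
      have h2 : γ ^ (k + 1) / 8 * n ≤ γ ^ k / 8 * n := mul_le_mul_of_nonneg_right hεk hn'.le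
      have h3 : (γ ^ k / 2) * n ≤ μab * n := by nlinarith
      exact le_of_mul_le_mul_right h3 hn'
    -- Passing between frequencies and probabilities for parent and child costs at most two
    -- tolerances, `γ ^ (k + 1) / 4`, which is at most `γ / 2 * μab`.
    have hμd : ∀ d, γ / 2 * μab ≤ (inputLaw f).real (box (lo d) (hi' d)) := fun d => by
      have hcld := hclose (lo d) (hi' d) (hmemIcc _ (hlo0 d) ((hlohi d).trans (hhi1 d)))
        (hmemIcc _ ((hlo0 d).trans (hlohi d)) (hhi1 d))
      have g1 := (abs_le.1 hcld).2
      have g2 := (abs_le.1 hcl).1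
      rw [hcountbox] at g2
      have g3 := (hbal' d).trans (hcountd d)
      have g4 : γ * (n * μab - γ ^ (k + 1) / 8 * n) ≤ γ * obsCount n X (t.region v) :=
        mul_le_mul_of_nonneg_left (by linarith) hγ.le
      have g5 : γ * (γ ^ (k + 1) / 8 * n) ≤ γ ^ (k + 1) / 8 * n :=
        mul_le_of_le_one_left (by positivity) hγ1
      have g6 : γ ^ (k + 1) / 4 ≤ γ / 2 * μab := by
        rw [pow_succ]; nlinarith
      have g7 : (γ / 2 * μab) * n ≤ (inputLaw f).real (box (lo d) (hi' d)) * n := by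
        nlinarith
      exact le_of_mul_le_mul_right g7 hn'
    refine ⟨lo c, hi' c, hlo0 c, hlohi c, hhi1 c, hboxd c, ?_, ?_⟩
    · rw [List.length_append, List.length_singleton, pow_succ']
      refine le_trans ?_ (hbal' c)
      rw [mul_assoc]
      exact mul_le_mul_of_nonneg_left hcount hγ.le
    · rw [RegTree.splitCount_append_singleton, hi]
      by_cases hij : i = j
      · subst hij
        rw [if_pos rfl, pow_succ']
        -- The sibling is bounded from below: it keeps the fraction `γ / 2 * c₁ / c₂` of the side,
        -- so the child at hand loses at least that much.
        have hr := side_le_of_measure_le hc₁ hf h0 hab h1 (hlo0 !c) (hlohi !c) (hhi1 !c) i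
          (hlo_ne !c) (hhi_ne !c) (by positivity : 0 ≤ γ / 2)
          (lt_of_lt_of_le (by positivity) hμlow) (hμd !c)
        have hsum : (hi' c i - lo c i) + (hi' (!c) i - lo (!c) i) = b i - a i := by
          cases c <;> simp [lo, hi']
        have := mul_le_mul_of_nonneg_left hside hκ
        linarith
      · rw [if_neg (by simpa using hij), add_zero, hlo_ne c j (Ne.symm hij),
          hhi_ne c j (Ne.symm hij)]
        exact hside

/-- A wide cell of a balanced tree reveals a point of a fixed grid whose node has few ancestors
split along the corresponding variable. -/
theorem exists_splitCount_lt_of_not_meshLE [IsProbabilityMeasure (inputLaw f)] (hc₁ : 0 < c₁)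
    (hf : ∀ x, c₁ ≤ f x ∧ f x ≤ c₂) {γ : ℝ} (hγ : 0 < γ) (hγ1 : γ ≤ 1) {n k r N : ℕ}
    (hn : 0 < n) {X : ℕ → Fin p → ℝ} (hX : ∀ i, X i ∈ box (0 : Fin p → ℝ) 1) {t : RegTree p}
    (hbal : t.IsBalanced γ n X) (hclose : UniformlyClose (inputLaw f) (γ ^ (k + 1) / 8) n X)
    (hdepth : k ≤ t.minLeafDepth) {δ : ℝ} (hN : 2 / N < δ) (hN0 : 0 < N)
    (hr : (1 - γ / 2 * c₁ / c₂) ^ r < δ / 2) (hmesh : ¬ t.MeshLE δ) :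
    ∃ (j : Fin p) (i : Fin (N + 1)), ∃ v : List Bool, v.length = k ∧
      (fun _ => (i : ℝ) / N) ∈ t.region v ∧ t.splitCount j v < r := by
  have hc₂ : 0 < c₂ := hc₁.trans_le ((hf 0).1.trans (hf 0).2)
  have hN' : (0 : ℝ) < N := by exact_mod_cast hN0
  have hδ : 0 < δ := lt_of_le_of_lt (by positivity) hN
  have hκ : 0 ≤ 1 - γ / 2 * c₁ / c₂ := by
    rw [sub_nonneg, div_le_one hc₂]
    have := (hf 0).1.trans (hf 0).2
    nlinarith
  have hκ1 : 1 - γ / 2 * c₁ / c₂ ≤ 1 := by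
    have : 0 ≤ γ / 2 * c₁ / c₂ := by positivity
    linarith
  obtain ⟨j, u, hu, u', hu', hlab, hlt⟩ : ∃ j, ∃ u ∈ Set.Icc (0 : ℝ) 1, ∃ u' ∈ Set.Icc (0 : ℝ) 1,
      t.cellLabel j u = t.cellLabel j u' ∧ δ < u' - u := by
    simp only [RegTree.MeshLE, not_forall, not_le] at hmesh
    obtain ⟨j, u, hu, u', hu', hlab, hlt⟩ := hmesh
    rcases le_total u u' with h | h
    · exact ⟨j, u, hu, u', hu', hlab, by rwa [abs_sub_comm, abs_of_nonneg (sub_nonneg.2 h)] at hlt⟩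
    · exact ⟨j, u', hu', u, hu, hlab.symm, by rwa [abs_of_nonneg (sub_nonneg.2 h)] at hlt⟩
  rw [cellLabel_eq_iff] at hlab
  have hu0N : 0 ≤ u * N := mul_nonneg hu.1 hN'.le
  have hfl1 : u * N < ⌊u * N⌋₊ + 1 := Nat.lt_floor_add_one _
  have hfl2 : (⌊u * N⌋₊ : ℝ) ≤ u * N := Nat.floor_le hu0N
  -- The first grid value strictly above `u`. As `1 / N < δ / 2`, it stays more than `δ / 2` below
  -- `u'`; the point tested is the diagonal one with all coordinates `w`.
  set w : ℝ := ((⌊u * N⌋₊ + 1 : ℕ) : ℝ) / N with hw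
  have huw : u < w := by
    rw [hw, lt_div_iff₀ hN']; push_cast; exact hfl1
  have hwu : w ≤ u + δ / 2 := by
    have h1 : (1 : ℝ) / N < δ / 2 := by
      rw [div_lt_iff₀ hN'] at hN ⊢; linarith
    have h2 : w ≤ u + 1 / N := by
      rw [hw, div_le_iff₀ hN', add_mul, one_div, inv_mul_cancel₀ hN'.ne']
      push_cast
      linarith
    linarith
  have hwu' : w < u' := by linarith
  have hw1 : w < 1 := hwu'.trans_le hu'.2
  have hidx : ⌊u * N⌋₊ + 1 < N + 1 := by
    rw [hw, div_lt_one hN'] at hw1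
    have : ⌊u * N⌋₊ + 1 < N := by exact_mod_cast hw1
    omega
  obtain ⟨v, hvk, hxv⟩ := t.exists_mem_region k hdepth (fun _ => w)
  refine ⟨j, ⟨⌊u * N⌋₊ + 1, hidx⟩, v, hvk, hxv, ?_⟩
  obtain ⟨a, b, h0, hab, h1, hbox, -, hside⟩ :=
    exists_box_of_isBalanced hc₁ hf hγ hγ1 hn hX hbal hclose j v hvk.le ⟨_, hxv⟩
  -- No split along `j` separates `u` from `u'`, hence none separates `w` from `u'`. So `y` lies in
  -- the same node, whose side along `j` exceeds `δ / 2`; with `r` or more splits it would be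
  -- shorter.
  set y : Fin p → ℝ := Function.update (fun _ => w) j u' with hy
  have hyv : y ∈ t.region v := by
    refine t.mem_region_of_forall_iff v hxv fun i s hs => ?_
    rcases eq_or_ne i j with rfl | hij
    · rw [hy, Function.update_self]
      exact ⟨fun h => hwu'.le.trans h, fun h => (hlab s hs).1 (huw.le.trans h)⟩
    · rw [hy, Function.update_of_ne hij]
  have hw0 : 0 < w := hu.1.trans_lt huw
  have hx1 : (fun _ => w) ∈ box a b := by
    rw [← hbox]; exact ⟨hxv, mem_box.2 fun i => ⟨hw0, hw1.le⟩⟩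
  have hy1 : y ∈ box a b := by
    rw [← hbox]
    refine ⟨hyv, mem_box.2 fun i => ?_⟩
    rcases eq_or_ne i j with rfl | hij
    · rw [hy, Function.update_self]
      exact ⟨hw0.trans hwu', hu'.2⟩
    · rw [hy, Function.update_of_ne hij]
      exact ⟨hw0, hw1.le⟩
  have g1 := (mem_box.1 hx1 j).1
  have g2 := (mem_box.1 hy1 j).2
  rw [hy, Function.update_self] at g2
  by_contra! hcon
  have h2 := pow_le_pow_of_le_one hκ hκ1 hcon
  linarith

end Mesh

theorem RandomizedSplits.mono {p : ℕ} {Ω : Type*} {D : MeasurableSpace Ω}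
    [mΩ : MeasurableSpace Ω] {P : Measure Ω} {π π' : ℝ} (h : π' ≤ π) {τ : Ω → RegTree p}
    (hr : RandomizedSplits P π D τ) : RandomizedSplits P π' D τ := by
  intro v j
  filter_upwards [hr v j] with ω hω hs using h.trans (hω hs)

/-! ### The mesh tends to zero in probability -/

section MeshLimit

variable {p : ℕ} {f : (Fin p → ℝ) → ℝ} {c₁ c₂ : ℝ} {Ω : Type*} [mΩ : MeasurableSpace Ω]
  {P : Measure Ω} [IsProbabilityMeasure P] {X : ℕ → Ω → Fin p → ℝ}

/-- Node boxes are half-open, so observations are required to avoid the null faces where a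
coordinate vanishes. -/
theorem ae_mem_unit_box : ∀ᵐ x ∂(cubeMeasure p), x ∈ box (0 : Fin p → ℝ) 1 := by
  have h : (cubeMeasure p).real (box 0 1) = 1 := by
    rw [cubeMeasure_real_box le_rfl zero_le_one le_rfl]
    simp
  rw [measureReal_def, ENNReal.toReal_eq_one_iff] at h
  exact (mem_ae_iff_prob_eq_one (measurableSet_box _ _)).2 h

theorem RegTree.IsBalanced.mono {γ γ' : ℝ} (h : γ' ≤ γ) {n : ℕ} {X : ℕ → Fin p → ℝ}
    {t : RegTree p} (ht : t.IsBalanced γ n X) : t.IsBalanced γ' n X := fun v hv b =>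
  (mul_le_mul_of_nonneg_right h (Nat.cast_nonneg _)).trans (ht v hv b)

/-- The partitions of deep, balanced and randomized trees become arbitrarily fine, in
probability. -/
theorem tendsto_measure_not_meshLE [IsProbabilityMeasure (inputLaw f)] (hc₁ : 0 < c₁)
    (hf : ∀ x, c₁ ≤ f x ∧ f x ≤ c₂) (hX : ∀ i, Measurable (X i))
    (hXlaw : ∀ i, P.map (X i) = inputLaw f)
    (hindep : Pairwise fun i j => IndepFun (X i) (X j) P)
    {D : ℕ → MeasurableSpace Ω} (hD : ∀ n, D n ≤ mΩ) {τ : ℕ → Ω → RegTree p}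
    (hτ : ∀ n, Measurable (τ n))
    (hdepth : ∀ k : ℕ, Tendsto (fun n => P {ω | (τ n ω).minLeafDepth < k}) atTop (𝓝 0))
    {γ : ℝ} (hγ : 0 < γ) (hbal : ∀ n, ∀ᵐ ω ∂P, (τ n ω).IsBalanced γ n (fun i => X i ω))
    {π : ℝ} (hπ : 0 < π) (hr : ∀ n, RandomizedSplits P π (D n) (τ n)) {δ : ℝ} (hδ : 0 < δ) :
    Tendsto (fun n => P {ω | ¬ (τ n ω).MeshLE δ}) atTop (𝓝 0) := by
  -- Lowering `γ` or `π` to one only weakens the corresponding assumption.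
  wlog hγ1 : γ ≤ 1 generalizing γ
  · exact this one_pos (fun n => (hbal n).mono fun ω h => h.mono (not_le.1 hγ1).le) le_rfl
  wlog hπ1 : π ≤ 1 generalizing π
  · exact this one_pos (fun n => (hr n).mono (not_le.1 hπ1).le) le_rfl
  have hc₂ : 0 < c₂ := hc₁.trans_le ((hf 0).1.trans (hf 0).2)
  obtain ⟨N, hN⟩ := exists_nat_gt (2 / δ)
  have hN0 : (0 : ℝ) < N := lt_trans (by positivity) hN
  have hNδ : 2 / (N : ℝ) < δ := by
    rw [div_lt_iff₀ hδ] at hN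
    rw [div_lt_iff₀ hN0]
    linarith
  have hκ : 0 ≤ 1 - γ / 2 * c₁ / c₂ := by
    rw [sub_nonneg, div_le_one hc₂]
    have := (hf 0).1.trans (hf 0).2
    nlinarith
  have hκ1 : 1 - γ / 2 * c₁ / c₂ < 1 := by
    have : 0 < γ / 2 * c₁ / c₂ := by positivity
    linarith
  -- The grid size `N` and the number `r` of splits needed depend on `δ` alone; then the depth `k`
  -- is chosen from `ε`, and finally the sample size, since the tolerance for boxes depends on `k`.
  obtain ⟨r, hr'⟩ := exists_pow_lt_of_lt_one (half_pos hδ) hκ1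
  rw [ENNReal.tendsto_atTop_zero]
  intro ε hε
  have hk : Tendsto (fun k : ℕ => ∑ _ji : Fin p × Fin (N + 1),
      ENNReal.ofReal (2 ^ r * (1 - π / 2) ^ k)) atTop (𝓝 0) := by
    have h1 : Tendsto (fun k : ℕ => (2 : ℝ) ^ r * (1 - π / 2) ^ k) atTop (𝓝 (2 ^ r * 0)) :=
      (tendsto_pow_atTop_nhds_zero_of_lt_one (by linarith) (by linarith)).const_mul _
    rw [mul_zero] at h1
    have h2 := ENNReal.tendsto_ofReal h1
    rw [ENNReal.ofReal_zero] at h2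
    simpa using tendsto_finsetSum (Finset.univ : Finset (Fin p × Fin (N + 1))) fun _ _ => h2
  obtain ⟨k, hk⟩ := (hk.eventually_le_const (ENNReal.half_pos hε.ne')).exists
  have hA : Tendsto (fun n => P {ω | (τ n ω).minLeafDepth < k} +
      P {ω | ¬ UniformlyClose (inputLaw f) (γ ^ (k + 1) / 8) n (fun i => X i ω)}) atTop (𝓝 0) := by
    simpa using (hdepth k).add (tendsto_measure_not_uniformlyClose hc₂.le (fun x => (hf x).2) hX
      hXlaw hindep (ε := γ ^ (k + 1) / 8) (by positivity))
  obtain ⟨n₀, hn₀⟩ := eventually_atTop.1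
    ((hA.eventually_le_const (ENNReal.half_pos hε.ne')).and (eventually_gt_atTop 0))
  refine ⟨n₀, fun n hn => ?_⟩
  obtain ⟨hAn, hn0⟩ := hn₀ n hn
  have hXbox : ∀ᵐ ω ∂P, ∀ i, X i ω ∈ box (0 : Fin p → ℝ) 1 := by
    rw [ae_all_iff]
    intro i
    have h : ∀ᵐ x ∂(P.map (X i)), x ∈ box (0 : Fin p → ℝ) 1 := by
      rw [hXlaw i]
      exact inputLaw_absolutelyContinuous ae_mem_unit_box
    exact ae_of_ae_map (hX i).aemeasurable h
  set E : Fin p × Fin (N + 1) → Set Ω := fun ji => {ω | ∃ v : List Bool, v.length = k ∧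
    (fun _ => (ji.2 : ℝ) / N) ∈ (τ n ω).region v ∧ (τ n ω).splitCount ji.1 v < r} with hE
  calc P {ω | ¬ (τ n ω).MeshLE δ}
      ≤ P (({ω | (τ n ω).minLeafDepth < k} ∪
          {ω | ¬ UniformlyClose (inputLaw f) (γ ^ (k + 1) / 8) n (fun i => X i ω)}) ∪
          ⋃ ji ∈ (Finset.univ : Finset (Fin p × Fin (N + 1))), E ji) := by
        refine measure_mono_ae ?_
        filter_upwards [hXbox, hbal n] with ω h1 h2 hmesh
        by_contra hcon
        have hcon : ω ∉ (({ω | (τ n ω).minLeafDepth < k} ∪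
          {ω | ¬ UniformlyClose (inputLaw f) (γ ^ (k + 1) / 8) n (fun i => X i ω)}) ∪
          ⋃ ji ∈ (Finset.univ : Finset (Fin p × Fin (N + 1))), E ji) := hcon
        simp only [Set.mem_union, Set.mem_ofPred_eq, not_or, not_lt, not_not, Set.mem_iUnion,
          Finset.mem_univ, not_exists, true_implies] at hcon
        obtain ⟨⟨h3, h4⟩, h5⟩ := hcon
        obtain ⟨j, i, hji⟩ := exists_splitCount_lt_of_not_meshLE hc₁ hf hγ hγ1 hn0 h1 h2 h4 h3
          hNδ (by exact_mod_cast hN0) hr' hmesh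
        exact h5 (j, i) hji
    _ ≤ (P {ω | (τ n ω).minLeafDepth < k} +
          P {ω | ¬ UniformlyClose (inputLaw f) (γ ^ (k + 1) / 8) n (fun i => X i ω)}) +
        ∑ ji : Fin p × Fin (N + 1), P (E ji) :=
        (measure_union_le _ _).trans
          (add_le_add (measure_union_le _ _) (measure_biUnion_finset_le _ _))
    _ ≤ ε / 2 + ∑ _ji : Fin p × Fin (N + 1), ENNReal.ofReal (2 ^ r * (1 - π / 2) ^ k) :=
        add_le_add hAn (Finset.sum_le_sum fun ji _ =>
          measure_splitCount_lt_le (hD n) (hτ n) (hr n) hπ1 _ ji.1 k r)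
    _ ≤ ε / 2 + ε / 2 := add_le_add le_rfl hk
    _ = ε := ENNReal.add_halves ε

theorem dataSigma_le {Y : ℕ → Ω → ℝ} (hX : ∀ i, Measurable (X i)) (hY : ∀ i, Measurable (Y i))
    (n : ℕ) : dataSigma X Y n ≤ mΩ :=
  iSup_le fun i => ((hX i).prodMk (hY i)).comap_le

/-- A density that is bounded and Lipschitz on the cube has a global extension that is bounded
and Lipschitz with the same constants. -/
theorem exists_lipschitzWith_extension {K : NNReal}
    (hf : ∀ x ∈ Set.Icc (0 : Fin p → ℝ) 1, c₁ ≤ f x ∧ f x ≤ c₂)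
    (hLip : LipschitzOnWith K f (Set.Icc 0 1)) :
    ∃ f' : (Fin p → ℝ) → ℝ, LipschitzWith K f' ∧ (∀ x, c₁ ≤ f' x ∧ f' x ≤ c₂) ∧
      inputLaw f' = inputLaw f := by
  -- Coordinatewise clamping is a 1-Lipschitz retraction onto the cube, so composing with it
  -- preserves the bounds and the Lipschitz constant.
  set c : (Fin p → ℝ) → (Fin p → ℝ) := fun x i => max 0 (min 1 (x i)) with hc
  have hmem : ∀ x, c x ∈ Set.Icc (0 : Fin p → ℝ) 1 := fun x =>
    ⟨fun i => le_max_left _ _, fun i => max_le zero_le_one (min_le_left _ _)⟩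
  have hdist : ∀ x y, dist (c x) (c y) ≤ dist x y := fun x y => by
    rw [dist_pi_le_iff dist_nonneg]
    intro i
    refine le_trans ?_ (dist_le_pi_dist x y i)
    rw [Real.dist_eq, Real.dist_eq]
    refine (abs_max_sub_max_le_max _ _ _ _).trans ?_
    rw [sub_self, abs_zero, max_eq_right (abs_nonneg _)]
    refine (abs_min_sub_min_le_max _ _ _ _).trans ?_
    rw [sub_self, abs_zero, max_eq_right (abs_nonneg _)]
  refine ⟨fun x => f (c x), LipschitzWith.of_dist_le_mul fun x y => ?_, fun x => hf _ (hmem x),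
    inputLaw_congr fun x hx => ?_⟩
  · exact (hLip.dist_le_mul _ (hmem x) _ (hmem y)).trans
      (mul_le_mul_of_nonneg_left (hdist x y) K.2)
  · have : c x = x := funext fun i => by
      simp only [hc]
      have h0 : 0 ≤ x i := hx.1 i
      have h1 : x i ≤ 1 := hx.2 i
      rw [min_eq_right h1, max_eq_right h0]
    rw [this]

end MeshLimit

end TreeHFD

/-! ### Convergence of the components -/

theorem corollary1 {p M : ℕ} {Ω : Type*} [MeasurableSpace Ω]
    (P : Measure Ω) [IsProbabilityMeasure P]
    -- the input density: bounded away from zero and infinity, and Lipschitz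
    (f : (Fin p → ℝ) → ℝ) (c₁ c₂ : ℝ) (hc₁ : 0 < c₁)
    (hf : ∀ x ∈ Set.Icc (0 : Fin p → ℝ) 1, c₁ ≤ f x ∧ f x ≤ c₂)
    (K : NNReal) (hLip : LipschitzOnWith K f (Set.Icc 0 1))
    -- the regression function and its HFD
    (m : (Fin p → ℝ) → ℝ) (hm : MemLp m 2 (inputLaw f))
    (mc : (J : Finset (Fin p)) → (J → ℝ) → ℝ) (hmc : IsHFD (inputLaw f) m mc)
    -- the i.i.d. training observations
    (X : ℕ → Ω → Fin p → ℝ) (Y ε : ℕ → Ω → ℝ)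
    (hX : ∀ i, Measurable (X i)) (hY : ∀ i, Measurable (Y i)) (hε : ∀ i, Measurable (ε i))
    (hmodel : ∀ i ω, Y i ω = m (X i ω) + ε i ω)
    (hXlaw : ∀ i, P.map (X i) = inputLaw f)
    (hεlaw : ∀ i, IdentDistrib (ε i) (ε 0) P P)
    (hXε : ∀ i, IndepFun (X i) (ε i) P)
    (hindep : iIndepFun (fun i ω => (X i ω, ε i ω)) P)
    -- for the sample size `n`, the random trees of the ensemble
    (tree : ℕ → Fin M → Ω → RegTree p) (htree : ∀ n ℓ, Measurable (tree n ℓ))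
    -- consistency in mean square, over the training stage and a new independent input
    (hcons : Tendsto (fun n => ∫⁻ ω, ∫⁻ x,
        ENNReal.ofReal ((m x - ∑ ℓ, (tree n ℓ ω).predict x) ^ 2) ∂(inputLaw f) ∂P)
      atTop (𝓝 0))
    -- bounded trees
    (B : ℝ) (hbdd : ∀ n ℓ, ∀ᵐ ω ∂P, ∀ x ∈ Set.Icc (0 : Fin p → ℝ) 1,
      |(tree n ℓ ω).predict x| ≤ B)
    -- the tree depth tends to infinity (in probability)
    (hdepth : ∀ (ℓ : Fin M) (k : ℕ),
      Tendsto (fun n => P {ω | (tree n ℓ ω).minLeafDepth < k}) atTop (𝓝 0))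
    -- balanced splits
    (γ : ℝ) (hγ : 0 < γ)
    (hbal : ∀ n ℓ, ∀ᵐ ω ∂P, (tree n ℓ ω).IsBalanced γ n (fun i => X i ω))
    -- randomized splits
    (π : ℝ) (hπ : 0 < π)
    (hrand : ∀ n ℓ, RandomizedSplits P π (dataSigma X Y n) (tree n ℓ))
    -- the tree HFD of each realized ensemble
    (η : ℕ → Ω → Fin M → (J : Finset (Fin p)) → (J → ℝ) → ℝ)
    (hη : ∀ n ω, IsTreeHFD (inputLaw f) (fun ℓ => tree n ℓ ω) (η n ω)) :
    ∀ J : Finset (Fin p),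
      Tendsto (fun n => ∫⁻ ω, ∫⁻ x,
          ENNReal.ofReal (((∑ ℓ, η n ω ℓ J (J.restrict x)) - mc J (J.restrict x)) ^ 2)
            ∂(inputLaw f) ∂P)
        atTop (𝓝 0) := by
  -- Only the input law matters, so the density may be replaced by its global extension.
  obtain ⟨f', hLip', hf', hlaw⟩ := exists_lipschitzWith_extension hf hLip
  rw [← hlaw] at hmc hcons
  simp only [← hlaw] at hXlaw hη ⊢
  have hfm : Measurable f' := hLip'.continuous.measurable
  have : IsProbabilityMeasure (inputLaw f') := by
    rw [← hXlaw 0]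
    exact Measure.isProbabilityMeasure_map (hX 0).aemeasurable
  have hpair : Pairwise fun i j => IndepFun (X i) (X j) P := fun i j hij =>
    (hindep.indepFun hij).comp measurable_fst measurable_fst
  obtain ⟨C, D, R, hC, hD, hR, hmain⟩ := exists_integral_sub_sq_le hfm hc₁ hf' hLip' hmc B M
  intro J
  have hmesh : ∀ δ : ℝ, 0 < δ →
      Tendsto (fun n => P {ω | ¬ ∀ ℓ, (tree n ℓ ω).MeshLE δ}) atTop (𝓝 0) := by
    intro δ hδ
    have h1 : Tendsto (fun n => ∑ ℓ, P {ω | ¬ (tree n ℓ ω).MeshLE δ}) atTop (𝓝 0) := by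
      simpa using tendsto_finsetSum Finset.univ fun ℓ _ =>
        tendsto_measure_not_meshLE hc₁ hf' hX hXlaw hpair (dataSigma_le hX hY)
          (fun n => htree n ℓ) (hdepth ℓ) hγ (fun n => hbal n ℓ) hπ (fun n => hrand n ℓ) hδ
    refine tendsto_of_tendsto_of_tendsto_of_le_of_le tendsto_const_nhds h1 (fun n => zero_le)
      fun n => (measure_mono fun ω hω => ?_).trans (measure_biUnion_finset_le _ _)
    simpa using hω
  have hbound : ∀ δ : ℝ, 0 < δ → ∀ n, ∫⁻ ω, ∫⁻ x,
      ENNReal.ofReal (((∑ ℓ, η n ω ℓ J (J.restrict x)) - mc J (J.restrict x)) ^ 2)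
        ∂(inputLaw f') ∂P ≤
      (ENNReal.ofReal C * (∫⁻ ω, ∫⁻ x,
        ENNReal.ofReal ((m x - ∑ ℓ, (tree n ℓ ω).predict x) ^ 2) ∂(inputLaw f') ∂P) +
        ENNReal.ofReal R * P {ω | ¬ ∀ ℓ, (tree n ℓ ω).MeshLE δ}) + ENNReal.ofReal (D * δ) := by
    intro δ hδ n
    -- The mesh event need not be measurable; its measurable hull has the same probability, so the
    -- upper bound can be integrated exactly.
    set bad := toMeasurable P {ω | ¬ ∀ ℓ, (tree n ℓ ω).MeshLE δ} with hbad
    have hbadm : MeasurableSet bad := measurableSet_toMeasurable _ _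
    have e : ∫⁻ ω, ((ENNReal.ofReal C * ∫⁻ x,
          ENNReal.ofReal ((m x - ∑ ℓ, (tree n ℓ ω).predict x) ^ 2) ∂(inputLaw f')) +
          bad.indicator (fun _ => ENNReal.ofReal R) ω) + ENNReal.ofReal (D * δ) ∂P =
        (ENNReal.ofReal C * (∫⁻ ω, ∫⁻ x,
          ENNReal.ofReal ((m x - ∑ ℓ, (tree n ℓ ω).predict x) ^ 2) ∂(inputLaw f') ∂P) +
          ENNReal.ofReal R * P {ω | ¬ ∀ ℓ, (tree n ℓ ω).MeshLE δ}) + ENNReal.ofReal (D * δ) := by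
      rw [lintegral_add_right _ measurable_const,
        lintegral_add_right _ (measurable_const.indicator hbadm),
        lintegral_const_mul' _ _ ENNReal.ofReal_ne_top, lintegral_indicator_const hbadm,
        lintegral_const, measure_univ, mul_one, hbad, measure_toMeasurable]
    rw [← e]
    refine lintegral_mono_ae ?_
    have hb : ∀ᵐ ω ∂P, ∀ ℓ, ∀ x ∈ Set.Icc (0 : Fin p → ℝ) 1, |(tree n ℓ ω).predict x| ≤ B :=
      ae_all_iff.2 fun ℓ => hbdd n ℓ
    filter_upwards [hb] with ω hω
    obtain ⟨hT, hJ⟩ := hmain (fun ℓ => tree n ℓ ω) (η n ω) (hη n ω) hω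
    obtain ⟨hg, hgR, hgδ⟩ := hJ J
    rw [← ofReal_integral_eq_lintegral_ofReal hg.integrable_sq
        (Eventually.of_forall fun x => sq_nonneg _),
      ← ofReal_integral_eq_lintegral_ofReal hT.integrable_sq
        (Eventually.of_forall fun x => sq_nonneg _)]
    -- Fine partitions give the error estimate with mesh `δ`; otherwise the uniform bound `R` is
    -- paid on the bad event.
    by_cases hωm : ∀ ℓ, (tree n ℓ ω).MeshLE δ
    · refine (ENNReal.ofReal_le_ofReal (hgδ δ hδ.le hωm)).trans ?_
      refine ENNReal.ofReal_add_le.trans ?_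
      rw [ENNReal.ofReal_mul hC]
      gcongr
      exact le_self_add
    · have hmem : ω ∈ bad := subset_toMeasurable _ _ hωm
      rw [Set.indicator_of_mem hmem]
      exact (ENNReal.ofReal_le_ofReal hgR).trans (le_add_self.trans le_self_add)
  rw [ENNReal.tendsto_atTop_zero]
  intro ε hε
  have hδ : Tendsto (fun k : ℕ => ENNReal.ofReal (D * (1 / ((k : ℝ) + 1)))) atTop (𝓝 0) := by
    have h1 := ENNReal.tendsto_ofReal
      ((tendsto_one_div_add_atTop_nhds_zero_nat (𝕜 := ℝ)).const_mul D)
    simpa using h1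
  -- The mesh is fixed before the sample size: it accounts for half of `ε`, and for this mesh the
  -- two remaining terms vanish in the limit.
  obtain ⟨k, hk⟩ := (hδ.eventually_le_const (ENNReal.half_pos hε.ne')).exists
  have hδ0 : (0 : ℝ) < 1 / ((k : ℝ) + 1) := by positivity
  have hlim : Tendsto (fun n => ENNReal.ofReal C * (∫⁻ ω, ∫⁻ x,
      ENNReal.ofReal ((m x - ∑ ℓ, (tree n ℓ ω).predict x) ^ 2) ∂(inputLaw f') ∂P) +
      ENNReal.ofReal R * P {ω | ¬ ∀ ℓ, (tree n ℓ ω).MeshLE (1 / ((k : ℝ) + 1))}) atTop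
      (𝓝 0) := by
    simpa using (ENNReal.Tendsto.const_mul hcons (Or.inr ENNReal.ofReal_ne_top)).add
      (ENNReal.Tendsto.const_mul (hmesh _ hδ0) (Or.inr ENNReal.ofReal_ne_top))
  obtain ⟨n₀, hn₀⟩ := eventually_atTop.1
    (hlim.eventually_le_const (ENNReal.half_pos hε.ne'))
  refine ⟨n₀, fun n hn => (hbound _ hδ0 n).trans ?_⟩
  exact (add_le_add (hn₀ n hn) hk).trans_eq (ENNReal.add_halves ε)
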